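/- Let $(R,\mathfrak m)$ be a regular local domain with $\dim R\ge 2$ and fraction field $K$, and let $I$ be an $\mathfrak m$-primary ideal of $R$. Notation. The normalized blowup $\operatorname{Proj}\overline{R[It]}$ is regarded as the set of all local subrings $B_P$ of $K$, where $B$ is the integral closure in $K$ of $R[I/a]$ for some $0\ne a\in I$, and $P$ is a prime ideal of $B$. Without taking integral closures one obtains the blowup $\operatorname{Proj}R[It]$. A local ring $T$ with $R\subseteq T\subseteq K$ dominates $R$ if its maximal ideal contracts to $\mathfrak m$. The points of the first neighborhood of $R$ are the local rings $T$ on $\operatorname{Proj}R[\mathfrak m t]$ that dominate $R$ and have $\dim T\ge 2$. Such a $T$ is a base point of $I$ if the transform $I^T=a^{-1}IT$ is a proper ideal of $T$, where $aT$ is the smallest principal ideal of $T$ containing $IT$. Let $\operatorname{ord}_R$ denote the valuation ring $\{f/g : f,g\in R,\ g\neq 0,\ \operatorname{ord}(g)\le \operatorname{ord}(f)\}$, where $\operatorname{ord}(f)=\sup\{n : f\in\mathfrak m^n\}$. Let $\operatorname{Rees} I$ denote the set of Rees valuation rings of $I$, that is, the discrete valuation rings $V$ on $\operatorname{Proj}\overline{R[It]}$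 with $IV\ne V$. Assume that $I$ has only finitely many base points in the first neighborhood of $R$. Let $S$ be a local ring on $\operatorname{Proj}\overline{R[It]}$ that dominates $R$. If either 1. $S$ is a unique factorization domain, or 2. $S$ has torsion divisor class group (for every divisorial fractional ideal $J$ of $S$ there is $n>0$ such that the divisorial hull $((J^n)^{-1})^{-1}$ is principal), and either $\operatorname{ord}_R\in\operatorname{Rees} I$ or $S\not\subseteq\operatorname{ord}_R$, then $\mathfrak m S$ is a principal ideal of $S$. -/

import Mathlib

noncomputable section

namespace BirationalModel

open IsLocalRing

section Models

variable {R K : Type*} [CommRing R] [Field K] [Algebra R K]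

/-- The localization `B_P = {b / c | b, c ∈ B, c ∉ P}`, formed inside the field `K`, of a subring
`B` of `K` containing (the image of) `R`, at a prime ideal `P` of `B`. -/
def localizationAt (B : Subalgebra R K) (P : Ideal B) [hP : P.IsPrime] : Subalgebra R K where
  carrier := {x | ∃ b c : B, c ∉ P ∧ x = (b : K) / (c : K)}
  mul_mem' := by
    rintro _ _ ⟨b, c, hc, rfl⟩ ⟨b', c', hc', rfl⟩
    refine ⟨b * b', c * c', fun h => (hP.mem_or_mem h).elim hc hc', ?_⟩
    push_cast
    rw [div_mul_div_comm]
  add_mem' := by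
    rintro _ _ ⟨b, c, hc, rfl⟩ ⟨b', c', hc', rfl⟩
    refine ⟨b * c' + c * b', c * c', fun h => (hP.mem_or_mem h).elim hc hc', ?_⟩
    have h : (c : K) ≠ 0 := fun h0 => hc (by
      have h1 : c = 0 := Subtype.ext h0
      exact h1 ▸ P.zero_mem)
    have h' : (c' : K) ≠ 0 := fun h0 => hc' (by
      have h1 : c' = 0 := Subtype.ext h0
      exact h1 ▸ P.zero_mem)
    push_cast
    rw [div_add_div _ _ h h']
  algebraMap_mem' := fun r =>
    ⟨algebraMap R B r, 1, fun h => hP.ne_top ((Ideal.eq_top_iff_one P).2 h), by simp⟩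

/-- The affine model of `B` : the set of all local rings `B_P`, with `P` a prime ideal of `B`. -/
def affineModel (B : Subalgebra R K) : Set (Subalgebra R K) :=
  {S | ∃ (P : Ideal B) (_ : P.IsPrime), S = localizationAt B P}

/-- The affine chart `R[I/a]`, generated over `R` by the fractions `b / a` with `b ∈ I`. -/
def blowupChart (K : Type*) [Field K] [Algebra R K] (I : Ideal R) (a : R) : Subalgebra R K :=
  Algebra.adjoin R {x : K | ∃ b ∈ I, x = algebraMap R K b / algebraMap R K a}

/-- The integral closure of the chart `R[I/a]` in `K`. -/
def normalizedBlowupChart (K : Type*) [Field K] [Algebra R K] (I : Ideal R) (a : R) :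
    Subalgebra R K :=
  (integralClosure (blowupChart K I a) K).restrictScalars R

/-- The blowup `Proj R[It]`, as a set of local rings with fraction field `K`: the union of the
affine models of the charts `R[I/a]`, `0 ≠ a ∈ I`. -/
def blowup (K : Type*) [Field K] [Algebra R K] (I : Ideal R) : Set (Subalgebra R K) :=
  {S | ∃ a ∈ I, a ≠ 0 ∧ S ∈ affineModel (blowupChart K I a)}

/-- The normalized blowup, that is, `Proj` of the integral closure of the Rees algebra `R[It]`,
as a set of local rings with fraction field `K`. The elements `a t`, `0 ≠ a ∈ I`, generate the
irrelevant ideal up to radical, and the degree zero part of the localization of the integral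
closure of `R[It]` at `a t` is the integral closure of `R[I/a]`. -/
def normalizedBlowup (K : Type*) [Field K] [Algebra R K] (I : Ideal R) : Set (Subalgebra R K) :=
  {S | ∃ a ∈ I, a ≠ 0 ∧ S ∈ affineModel (normalizedBlowupChart K I a)}

/-- `S` dominates the local ring `R`: elements of the maximal ideal of `R` are
nonunits of `S`. -/
def Dominates (S : Subalgebra R K) : Prop := IsLocalHom (algebraMap R S)

/-- The Rees valuation rings of `I`: the discrete valuation rings `V` on the normalized blowup
of `I` whose center on `R` contains `I` (the local rings of the prime divisors over `I`). -/
def reesValuationRings (K : Type*) [Field K] [Algebra R K] (I : Ideal R) :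
    Set (Subalgebra R K) :=
  {V | V ∈ normalizedBlowup K I ∧ IsDiscreteValuationRing V ∧ I.map (algebraMap R V) ≠ ⊤}

/-- `J` is the transform `a⁻¹IT` of `I` in `T`, where `aT` is the smallest principal ideal of `T`
containing `IT`. -/
def IsTransform (I : Ideal R) (T : Subalgebra R K) (J : Ideal T) : Prop :=
  ∃ a : T, a ≠ 0 ∧
    IsLeast {L : Ideal T | Submodule.IsPrincipal L ∧ I.map (algebraMap R T) ≤ L}
      (Ideal.span {a}) ∧
    Ideal.span {a} * J = I.map (algebraMap R T)

section Local

variable [IsLocalRing R]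

/-- The points infinitely near to the regular local ring `R` in its first neighborhood: the local
quadratic transforms of `R` (local rings on the blowup of the maximal ideal that dominate `R`)
of dimension at least two. They are automatically regular local rings. -/
def firstNeighborhood (R K : Type*) [CommRing R] [Field K] [Algebra R K] [IsLocalRing R] :
    Set (Subalgebra R K) :=
  {T | T ∈ blowup K (maximalIdeal R) ∧ Dominates T ∧ 2 ≤ ringKrullDim T}

/-- The base points of `I` in the first neighborhood of `R`: the points `T` of the first
neighborhood for which the transform of `I` in `T` is a proper ideal. -/
def basePointsInFirstNeighborhood (K : Type*) [Field K] [Algebra R K] (I : Ideal R) :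
    Set (Subalgebra R K) :=
  {T | T ∈ firstNeighborhood R K ∧ ∃ J : Ideal T, IsTransform I T J ∧ J ≠ ⊤}

/-- The order function of a local ring: `ord f = sup {n | f ∈ 𝔪ⁿ}`. -/
def ord (f : R) : ℕ∞ := ⨆ (n : ℕ) (_ : f ∈ maximalIdeal R ^ n), (n : ℕ∞)

/-- The valuation ring of the order valuation of a regular local ring `R` with fraction field `K`,
as a subset of `K`: the fractions `f / g` with `g ≠ 0` and `ord g ≤ ord f`. -/
def ordValuationRing (R K : Type*) [CommRing R] [Field K] [Algebra R K] [IsLocalRing R] : Set K :=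
  {x | ∃ f g : R, g ≠ 0 ∧ ord g ≤ ord f ∧ x = algebraMap R K f / algebraMap R K g}

end Local

end Models

open scoped nonZeroDivisors in
/-- The divisor class group of the normal domain `A` is a torsion group: every divisorial
fractional ideal `J` (nonzero with `(J⁻¹)⁻¹ = J`) has a power `Jⁿ`, `n > 0`, whose
divisorial hull `((Jⁿ)⁻¹)⁻¹`, which represents the `n`-th multiple of the class of `J`, is
principal. -/
def HasTorsionDivisorClassGroup (A : Type*) [CommRing A] [IsDomain A] : Prop :=
  ∀ J : FractionalIdeal A⁰ (FractionRing A), J ≠ 0 → (J⁻¹)⁻¹ = J →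
    ∃ n : ℕ, 0 < n ∧ ∃ x : FractionRing A, x ≠ 0 ∧
      ((J ^ n)⁻¹)⁻¹ = FractionalIdeal.spanSingleton A⁰ x

end BirationalModel

end

noncomputable section

set_option linter.unusedSectionVars false

open IsLocalRing

/-! Values are written additively in this overview; in the code valuations are multiplicative. Let
`IS = aS`, and let `r` be the order of `I`, so that `v(a) = v(I) ≥ r·v(𝔪)` for every valuation `v`
whose ring dominates `S`. The proof splits on whether equality occurs for some such `v`.

If equality never occurs, every such `v` is centered at a base point of `I` on the blowup of `𝔪`
(`transform_mem_basePoints`). There are finitely many of these, so homogeneous prime avoidance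
(`GeneratesPow.exists_forall`) gives one `F ∈ 𝔪ᵉ` generating `𝔪ᵉT` at every base point `T`. For `y ∈
𝔪ᵉ` the fraction `y/F` then lies in all valuation rings dominating `S`, hence in the integrally
closed ring `S`. So `𝔪ᵉS = FS`; thus `𝔪S` is invertible, and therefore principal because `S` is
local. The class group plays no role here.

If equality holds for `v`, let `T` be the center of `v` on the blowup of `𝔪`, with `𝔪T = xT`. Then
`a/xʳ` is a unit of `T`, and `S ⊆ T ⊆ ord_R`, which rules out the alternative `S ⊄ ord_R`. The class
group hypothesis gives `n > 0` and `g` generating the divisorial hull of `𝔪ⁿS`. As soon as `v(g) =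
n·v(𝔪)`, the element `aⁿ/gʳ` of `S` is a unit, so `aⁿ` generates `𝔪ⁿʳS` and `𝔪S` is again principal.
Writing `xⁿ = gu` in `T`, that equality follows if `u` has order 0, because `x` divides every
element of `T` of positive order. In the factorial case `n = 1`, and a prime factor of `a` divides
all of `𝔪S`, so `g` is a nonunit, which forces `ord u = 0`. In the torsion case the ring of `ord_R`
is a localization of `S`, in which the hull of `𝔪ⁿS` becomes generated by `xⁿ`.

The prerequisites, that `ord_R` is a valuation and that the charts `R[𝔪/x]` are integrally closed,
come from the associated graded ring being a polynomial ring (`map_residue_eq_zero_of_eval_mem`). -/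

/-! ### The associated graded ring of a regular local ring is a polynomial ring. -/

theorem Ideal.sup_pow_le {A : Type*} [CommRing A] (N J : Ideal A) (k : ℕ) :
    (N ⊔ J) ^ k ≤ N ⊔ J ^ k := by
  induction k with
  | zero => simp
  | succ k ih =>
    refine (pow_succ _ _).le.trans ((Ideal.mul_mono_left ih).trans ?_)
    rw [Ideal.sup_mul, Ideal.mul_sup (J ^ k)]
    exact sup_le (le_sup_of_le_left Ideal.mul_le_left) (sup_le (le_sup_of_le_left Ideal.mul_le_right)
      (le_sup_of_le_right (pow_succ J k).ge))

theorem MvPolynomial.IsHomogeneous.eval_mul_left {A ι : Type*} [CommRing A] {n : ℕ}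
    {H : MvPolynomial ι A} (hH : H.IsHomogeneous n) (t : A) (u : ι → A) :
    MvPolynomial.eval (fun i => t * u i) H = t ^ n * MvPolynomial.eval u H := by
  rw [MvPolynomial.eval_eq, MvPolynomial.eval_eq, Finset.mul_sum]
  refine Finset.sum_congr rfl fun d hd => ?_
  have h1 : ∑ i ∈ d.support, d i = n := hH.degree_eq_sum_deg_support hd ▸ rfl
  simp only [mul_pow, Finset.prod_mul_distrib, Finset.prod_pow_eq_pow_sum, h1]
  ring

/-- If the maximal ideal of a local ring is `N + (t)` and `tⁿ ∈ N + (tⁿ⁺¹)`, then `tⁿ ∈ N`. -/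
theorem IsLocalRing.pow_mem_of_mem_sup {A : Type*} [CommRing A] [IsLocalRing A] {N : Ideal A}
    {t : A} (ht : t ∈ maximalIdeal A) {n : ℕ}
    (h : t ^ n ∈ N ⊔ Ideal.span {t ^ (n + 1)}) : t ^ n ∈ N := by
  obtain ⟨a, ha, b, hb, hab⟩ := Submodule.mem_sup.1 h
  obtain ⟨s, rfl⟩ := Ideal.mem_span_singleton'.1 hb
  have hu : IsUnit (1 - s * t) :=
    by_contra fun hn => (maximalIdeal.isMaximal A).ne_top ((Ideal.eq_top_iff_one _).2 (by
      simpa using add_mem ((mem_maximalIdeal _).2 hn) (Ideal.mul_mem_left _ s ht)))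
  refine (Ideal.unit_mul_mem_iff_mem N hu).1 ?_
  have : (1 - s * t) * t ^ n = a := by linear_combination -hab
  rwa [this]

/-- Over an infinite residue field a nonzero reduction of `H` takes a unit value at some point,
which can be scaled to a `u` with `u j = 1`. Modulo the ideal `N` generated by the `x i - u i * x j`
with `i ≠ j`, `H(x)` becomes a unit times `x jⁿ`, so `x jⁿ ∈ N`. Then `𝔪` is minimal over an ideal
with fewer generators than its height, against Krull's height theorem. -/
theorem IsLocalRing.map_residue_eq_zero_of_eval_mem_of_infinite {A ι : Type*} [CommRing A]
    [IsNoetherianRing A] [IsLocalRing A] [Infinite (ResidueField A)] [Finite ι] {x : ι → A}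
    (hx : Ideal.span (Set.range x) = maximalIdeal A)
    (hd : (Nat.card ι : ℕ∞) ≤ (maximalIdeal A).height) {n : ℕ} {H : MvPolynomial ι A}
    (hH : H.IsHomogeneous n) (h : MvPolynomial.eval x H ∈ maximalIdeal A ^ (n + 1)) :
    MvPolynomial.map (residue A) H = 0 := by
  classical
  have := Fintype.ofFinite ι
  by_contra hne
  have hex : ∃ c : ι → ResidueField A, MvPolynomial.eval c (MvPolynomial.map (residue A) H) ≠ 0 := by
    by_contra! hall
    exact hne (MvPolynomial.funext fun c => by simpa using hall c)
  obtain ⟨c', hc'⟩ := hex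
  choose c hc using fun i => residue_surjective (R := A) (c' i)
  obtain rfl : (fun i => residue A (c i)) = c' := funext hc
  have hcu : IsUnit (MvPolynomial.eval c H) := by
    rw [← residue_ne_zero_iff_isUnit]
    rw [MvPolynomial.eval_map] at hc'
    rwa [MvPolynomial.eval, MvPolynomial.coe_eval₂Hom, MvPolynomial.hom_eval₂] 
  clear hc' hc hne
  by_cases hj : ∃ j, IsUnit (c j)
  swap
  · -- all coordinates are nonunits, so the form is constant
    push Not at hj
    have h0 : MvPolynomial.eval x H ∈ maximalIdeal A :=
      Ideal.pow_le_self (Nat.succ_ne_zero n) h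
    have e1 : residue A (MvPolynomial.eval c H) = residue A (MvPolynomial.eval x H) := by
      rw [MvPolynomial.eval, MvPolynomial.coe_eval₂Hom, MvPolynomial.hom_eval₂, MvPolynomial.eval,
        MvPolynomial.coe_eval₂Hom, MvPolynomial.hom_eval₂]
      congr 1
      funext i
      have h1 : residue A (c i) = 0 := (residue_eq_zero_iff _).2 (hj i)
      have h2 : residue A (x i) = 0 :=
        (residue_eq_zero_iff _).2 (hx ▸ Ideal.subset_span (Set.mem_range_self i))
      simp [h1, h2]
    rw [(residue_eq_zero_iff _).2 h0] at e1
    exact (residue_ne_zero_iff_isUnit _).2 hcu e1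
  obtain ⟨j, hj⟩ := hj
  obtain ⟨w, hw⟩ := hj.exists_left_inv
  set u : ι → A := fun i => w * c i with hu
  have huj : u j = 1 := hw
  have huu : IsUnit (MvPolynomial.eval u H) := by
    rw [hu, hH.eval_mul_left]
    exact ((IsUnit.of_mul_eq_one _ hw).pow n).mul hcu
  set s : Finset A := (Finset.univ.erase j).image fun i => x i - u i * x j with hs
  set N : Ideal A := Ideal.span (s : Set A) with hN
  have hxN : ∀ i, x i - u i * x j ∈ N := by
    intro i
    by_cases hij : i = j
    · subst hij; simp [huj]
    · exact Ideal.subset_span (by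
        simp only [hs, Finset.coe_image, Set.mem_image, Finset.mem_coe, Finset.mem_erase,
          Finset.mem_univ, and_true]
        exact ⟨i, hij, rfl⟩)
  have hxm : ∀ i, x i ∈ maximalIdeal A := fun i =>
    hx ▸ Ideal.subset_span (Set.mem_range_self i)
  have hNm : N ≤ maximalIdeal A := by
    rw [hN, Ideal.span_le]
    intro y hy
    simp only [hs, Finset.coe_image, Set.mem_image] at hy
    obtain ⟨i, -, rfl⟩ := hy
    exact sub_mem (hxm i) (Ideal.mul_mem_left _ _ (hxm j))
  have hmN : maximalIdeal A ≤ N ⊔ Ideal.span {x j} := by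
    rw [← hx, Ideal.span_le]
    rintro _ ⟨i, rfl⟩
    have : x i = (x i - u i * x j) + u i * x j := by ring
    rw [this]
    exact add_mem (Ideal.mem_sup_left (hxN i))
      (Ideal.mem_sup_right (Ideal.mul_mem_left _ _ (Ideal.mem_span_singleton_self _)))
  have hmap : MvPolynomial.eval x H - x j ^ n * MvPolynomial.eval u H ∈ N := by
    rw [← hH.eval_mul_left, ← Ideal.Quotient.eq]
    rw [MvPolynomial.eval, MvPolynomial.coe_eval₂Hom, MvPolynomial.hom_eval₂, MvPolynomial.eval,
        MvPolynomial.coe_eval₂Hom, MvPolynomial.hom_eval₂]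
    congr 1
    funext i
    refine Ideal.Quotient.eq.2 ?_
    rw [mul_comm (x j)]
    exact hxN i
  have hpow : maximalIdeal A ^ (n + 1) ≤ N ⊔ Ideal.span {x j ^ (n + 1)} := by
    refine (Ideal.pow_right_mono hmN _).trans ?_
    rw [← Ideal.span_singleton_pow]
    exact Ideal.sup_pow_le _ _ _
  have hxj : x j ^ n ∈ N := by
    refine pow_mem_of_mem_sup (hxm j) ?_
    have h1 : x j ^ n * MvPolynomial.eval u H ∈ N ⊔ Ideal.span {x j ^ (n + 1)} := by
      have := sub_mem (hpow h) (Ideal.mem_sup_left (T := Ideal.span {x j ^ (n + 1)}) hmap)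
      simpa using this
    exact (Ideal.mul_unit_mem_iff_mem _ huu).1 h1
  have hmin : maximalIdeal A ∈ N.minimalPrimes := by
    refine ⟨⟨inferInstance, hNm⟩, fun q ⟨hq, hNq⟩ _ => hmN.trans (sup_le hNq ?_)⟩
    rw [Ideal.span_singleton_le_iff_mem]
    exact hq.mem_of_pow_mem n (hNq hxj)
  have h1 := Ideal.height_le_card_of_mem_minimalPrimes_span_finset hmin
  have h2 : s.card < Nat.card ι := by
    refine (Finset.card_image_le).trans_lt ?_
    rw [Nat.card_eq_fintype_card, ← Finset.card_univ]
    exact Finset.card_erase_lt_of_mem (Finset.mem_univ j)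
  exact absurd (hd.trans h1) (not_le.2 (by exact_mod_cast h2))

/-- Reduction to an infinite residue field by passing to `A[X]` localized at `𝔪A[X]`: the maximal
ideal is still generated by `𝔪` and has the same height, and the powers of `X` stay distinct in the
residue field. -/
theorem IsLocalRing.map_residue_eq_zero_of_eval_mem {A ι : Type*} [CommRing A]
    [IsNoetherianRing A] [IsLocalRing A] [Finite ι] {x : ι → A}
    (hx : Ideal.span (Set.range x) = maximalIdeal A)
    (hd : (Nat.card ι : ℕ∞) ≤ (maximalIdeal A).height) {n : ℕ} {H : MvPolynomial ι A}
    (hH : H.IsHomogeneous n) (h : MvPolynomial.eval x H ∈ maximalIdeal A ^ (n + 1)) :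
    MvPolynomial.map (residue A) H = 0 := by
  set P : Ideal (Polynomial A) := (maximalIdeal A).map Polynomial.C with hP
  have hPp : P.IsPrime := Ideal.isPrime_map_C_of_isPrime
  set B := Localization.AtPrime P with hB
  set f : A →+* B := (algebraMap (Polynomial A) B).comp Polynomial.C with hf
  have hmax : maximalIdeal B = (maximalIdeal A).map f := by
    rw [hf, ← Ideal.map_map, ← hP, Localization.AtPrime.map_eq_maximalIdeal]
  have hloc : IsLocalHom f := by
    rw [((local_hom_TFAE f).out 0 2 :)]
    exact hmax.ge
  have hinf : Infinite (ResidueField B) := by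
    have : Function.Injective fun n : ℕ => residue B (algebraMap (Polynomial A) B (Polynomial.X ^ n)) := by
      intro a b hab
      by_contra hne
      have h1 : algebraMap (Polynomial A) B (Polynomial.X ^ a - Polynomial.X ^ b) ∈ maximalIdeal B := by
        rw [← residue_eq_zero_iff, map_sub, map_sub, sub_eq_zero]; exact hab
      have h2 : (Polynomial.X ^ a - Polynomial.X ^ b : Polynomial A) ∈ P := by
        rw [← IsLocalization.AtPrime.to_map_mem_maximal_iff B P] ; exact h1
      have h3 := Ideal.mem_map_C_iff.1 h2 a
      rw [Polynomial.coeff_sub, Polynomial.coeff_X_pow_self, Polynomial.coeff_X_pow, if_neg hne,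
        sub_zero] at h3
      exact (Ideal.ne_top_iff_one _).1 (maximalIdeal.isMaximal A).ne_top h3
    exact Infinite.of_injective _ this
  have hht : (maximalIdeal B).height = (maximalIdeal A).height := by
    rw [← Polynomial.height_map_C (maximalIdeal A), ← hP,
      ← IsLocalization.height_under P.primeCompl (maximalIdeal B),
      Localization.AtPrime.under_maximalIdeal]
  have key := IsLocalRing.map_residue_eq_zero_of_eval_mem_of_infinite (A := B)
    (x := fun i => f (x i)) (H := MvPolynomial.map f H) (n := n)
    (by rw [hmax, ← hx, Ideal.map_span, ← Set.range_comp]; rfl) (by rwa [hht]) (hH.map f) (by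
      have : MvPolynomial.eval (fun i => f (x i)) (MvPolynomial.map f H)
          = f (MvPolynomial.eval x H) := by
        rw [MvPolynomial.eval_map, MvPolynomial.eval, MvPolynomial.coe_eval₂Hom,
          MvPolynomial.hom_eval₂]; rfl
      rw [this, hmax, ← Ideal.map_pow]
      exact Ideal.mem_map_of_mem _ h)
  ext d
  have h1 := congrArg (MvPolynomial.coeff d) key
  rw [MvPolynomial.coeff_map, MvPolynomial.coeff_map, MvPolynomial.coeff_zero,
    residue_eq_zero_iff, mem_maximalIdeal, mem_nonunits_iff] at h1
  rw [MvPolynomial.coeff_map, MvPolynomial.coeff_zero, residue_eq_zero_iff, mem_maximalIdeal,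
    mem_nonunits_iff]
  exact fun h2 => h1 (h2.map f)

/-! ### Leading forms. -/

namespace MvPolynomial

/-- If a homogeneous form `F ≠ 0` is divisible by a homogeneous form `H`, then the quotient may be
taken homogeneous. -/
theorem IsHomogeneous.exists_homogeneous_of_dvd {k ι : Type*} [CommRing k]
    {F H : MvPolynomial ι k} {N s : ℕ} (hF : F.IsHomogeneous N) (hH : H.IsHomogeneous s)
    (hdvd : H ∣ F) (h0 : F ≠ 0) :
    ∃ e, N = s + e ∧ ∃ G : MvPolynomial ι k, G.IsHomogeneous e ∧ F = H * G := by
  obtain ⟨G, rfl⟩ := hdvd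
  -- Take the component of degree `N`: only the component of `G` of degree `N - s` contributes.
  have h1 : H * G = ∑ i ∈ Finset.range (G.totalDegree + 1),
      if s + i = N then H * homogeneousComponent i G else 0 := by
    conv_lhs => rw [← homogeneousComponent_eq_self hF]
    conv_lhs => rw [← sum_homogeneousComponent G, Finset.mul_sum, map_sum]
    refine Finset.sum_congr rfl fun i _ => ?_
    rw [homogeneousComponent_of_mem
      (m := N) (n := s + i) (hH.mul (homogeneousComponent_isHomogeneous i G))]
    simp [eq_comm]
  by_cases hs : s ≤ N
  · obtain ⟨e, rfl⟩ := Nat.exists_eq_add_of_le hs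
    refine ⟨e, rfl, homogeneousComponent e G, homogeneousComponent_isHomogeneous e G, ?_⟩
    rw [h1]
    simp only [add_right_inj]
    rw [Finset.sum_ite_eq']
    split_ifs with h
    · rfl
    · rw [homogeneousComponent_eq_zero, mul_zero]
      simpa [Nat.lt_succ_iff] using h
  · exact absurd (h1.trans (Finset.sum_eq_zero fun i _ => if_neg (by omega))) h0

end MvPolynomial

section LeadingForm

variable {R ι : Type*} [CommRing R] [IsLocalRing R]

/-- `F` is the class of `f ∈ 𝔪ⁿ` modulo `𝔪ⁿ⁺¹`, written as a form of degree `n` in the classes of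
the elements `x i`. -/
def IsLeadingForm (x : ι → R) (n : ℕ) (f : R) (F : MvPolynomial ι (ResidueField R)) : Prop :=
  ∃ P : MvPolynomial ι R, P.IsHomogeneous n ∧ MvPolynomial.map (residue R) P = F ∧
    f - MvPolynomial.eval x P ∈ maximalIdeal R ^ (n + 1)

variable {x : ι → R} (hx : Ideal.span (Set.range x) = maximalIdeal R)

namespace IsLeadingForm

theorem isHomogeneous {n : ℕ} {f : R} {F : MvPolynomial ι (ResidueField R)}
    (h : IsLeadingForm x n f F) : F.IsHomogeneous n := by
  obtain ⟨P, hP, rfl, -⟩ := h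
  exact hP.map _

include hx in
theorem exists_of_mem {n : ℕ} {f : R} (hf : f ∈ maximalIdeal R ^ n) :
    ∃ F, IsLeadingForm x n f F := by
  rw [← hx, Ideal.mem_span_pow_iff_exists_isHomogeneous] at hf
  obtain ⟨P, hP, rfl⟩ := hf
  exact ⟨_, P, hP, rfl, by simp⟩

include hx in
theorem eval_mem {n : ℕ} {P : MvPolynomial ι R} (hP : P.IsHomogeneous n) :
    MvPolynomial.eval x P ∈ maximalIdeal R ^ n := by
  rw [← hx, Ideal.mem_span_pow_iff_exists_isHomogeneous]
  exact ⟨P, hP, rfl⟩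

include hx in
theorem mem {n : ℕ} {f : R} {F : MvPolynomial ι (ResidueField R)}
    (h : IsLeadingForm x n f F) : f ∈ maximalIdeal R ^ n := by
  obtain ⟨P, hP, -, h⟩ := h
  simpa using add_mem (Ideal.pow_le_pow_right n.le_succ h) (eval_mem hx hP)

include hx in
theorem mem_succ {n : ℕ} {f : R} (h : IsLeadingForm x n f 0) : f ∈ maximalIdeal R ^ (n + 1) := by
  obtain ⟨P, hP, h0, h⟩ := h
  have : MvPolynomial.eval x P ∈ maximalIdeal R ^ (n + 1) := by
    rw [MvPolynomial.as_sum P, map_sum]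
    refine sum_mem fun d hd => ?_
    have h1 : MvPolynomial.monomial d (P.coeff d)
        = MvPolynomial.C (P.coeff d) * MvPolynomial.monomial d 1 := by
      rw [MvPolynomial.C_mul_monomial, mul_one]
    rw [h1, map_mul, MvPolynomial.eval_C, pow_succ']
    refine Ideal.mul_mem_mul ?_ (eval_mem hx (MvPolynomial.isHomogeneous_monomial _ ?_))
    · rw [← residue_eq_zero_iff, ← MvPolynomial.coeff_map, h0, MvPolynomial.coeff_zero]
    · exact (hP.degree_eq_sum_deg_support hd).symm
  simpa using add_mem h this

theorem sub {n : ℕ} {f g : R} {F G : MvPolynomial ι (ResidueField R)}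
    (hf : IsLeadingForm x n f F) (hg : IsLeadingForm x n g G) :
    IsLeadingForm x n (f - g) (F - G) := by
  obtain ⟨P, hP, rfl, hf⟩ := hf
  obtain ⟨Q, hQ, rfl, hg⟩ := hg
  refine ⟨P - Q, hP.sub hQ, by simp, ?_⟩
  convert sub_mem hf hg using 1
  rw [map_sub]; ring

include hx in
theorem mul {m n : ℕ} {f g : R} {F G : MvPolynomial ι (ResidueField R)}
    (hf : IsLeadingForm x m f F) (hg : IsLeadingForm x n g G) :
    IsLeadingForm x (m + n) (f * g) (F * G) := by
  have hgm := hg.mem hx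
  obtain ⟨P, hP, rfl, hf⟩ := hf
  obtain ⟨Q, hQ, rfl, hg⟩ := hg
  refine ⟨P * Q, hP.mul hQ, by simp, ?_⟩
  have h1 := Ideal.mul_mem_mul hf hgm
  have h2 := Ideal.mul_mem_mul (eval_mem hx hP) hg
  rw [← pow_add] at h1 h2
  rw [show m + 1 + n = m + n + 1 by ring] at h1
  convert add_mem h1 h2 using 1
  rw [map_mul]; ring

include hx in
theorem pow {n : ℕ} {f : R} {F : MvPolynomial ι (ResidueField R)}
    (hf : IsLeadingForm x n f F) (k : ℕ) : IsLeadingForm x (n * k) (f ^ k) (F ^ k) := by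
  induction k with
  | zero => exact ⟨1, by simpa using MvPolynomial.isHomogeneous_one ι R, by simp, by simp⟩
  | succ k ih => simpa only [pow_succ, mul_add, mul_one] using ih.mul hx hf

theorem exists_of_isHomogeneous (x : ι → R) {n : ℕ} {F : MvPolynomial ι (ResidueField R)}
    (hF : F.IsHomogeneous n) : ∃ f, IsLeadingForm x n f F := by
  obtain ⟨P, rfl⟩ := MvPolynomial.map_surjective (residue R) residue_surjective F
  refine ⟨_, MvPolynomial.homogeneousComponent n P,
    MvPolynomial.homogeneousComponent_isHomogeneous n P, ?_, by rw [sub_self]; exact zero_mem _⟩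
  conv_rhs => rw [← MvPolynomial.homogeneousComponent_eq_self hF]
  ext d
  simp only [MvPolynomial.coeff_map, MvPolynomial.coeff_homogeneousComponent]
  split_ifs <;> simp

variable [IsNoetherianRing R] [Finite ι] (hd : (Nat.card ι : ℕ∞) ≤ (maximalIdeal R).height)

include hx hd

theorem eq_zero {n : ℕ} {f : R} {F : MvPolynomial ι (ResidueField R)}
    (h : IsLeadingForm x n f F) (hf : f ∈ maximalIdeal R ^ (n + 1)) : F = 0 := by
  obtain ⟨P, hP, rfl, h⟩ := h
  exact map_residue_eq_zero_of_eval_mem hx hd hP (by simpa using sub_mem hf h)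

theorem unique {n : ℕ} {f : R} {F G : MvPolynomial ι (ResidueField R)}
    (h : IsLeadingForm x n f F) (h' : IsLeadingForm x n f G) : F = G :=
  sub_eq_zero.1 ((h.sub h').eq_zero hx hd (by simp))

end IsLeadingForm

end LeadingForm

/-! ### Regular local domains are integrally closed. -/

namespace IsRegularLocalRing

variable (R : Type*) [CommRing R] [IsRegularLocalRing R]

theorem exists_parameters : ∃ (d : ℕ) (x : Fin d → R),
    Ideal.span (Set.range x) = maximalIdeal R ∧
      (Nat.card (Fin d) : ℕ∞) ≤ (maximalIdeal R).height := by
  have hfg : (maximalIdeal R).FG := IsNoetherian.noetherian _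
  obtain ⟨s, hs, hspan⟩ := Submodule.FG.exists_span_set_encard_eq_spanFinrank hfg
  have hfin : s.Finite := by
    rw [← Set.encard_ne_top_iff, hs]; exact ENat.natCast_ne_top _
  have := hfin.fintype
  refine ⟨Fintype.card s, fun i => (Fintype.equivFin s).symm i, ?_, ?_⟩
  · have : Set.range (fun i => ((Fintype.equivFin s).symm i : R)) = s := by
      rw [show (fun i => ((Fintype.equivFin s).symm i : R))
        = Subtype.val ∘ (Fintype.equivFin s).symm from rfl, EquivLike.range_comp]
      simp
    rw [this]; exact hspan
  · have h1 : ((maximalIdeal R).spanFinrank : WithBot ℕ∞) = (maximalIdeal R).height := by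
      rw [maximalIdeal_height_eq_ringKrullDim, spanFinrank_maximalIdeal]
    have h2 : ((maximalIdeal R).spanFinrank : ℕ∞) = (maximalIdeal R).height := by
      exact_mod_cast h1
    rw [← h2, ← hs, Set.encard_eq_coe_toFinset_card]
    simp

variable {R}

theorem mul_notMem_pow {f g : R} {i j : ℕ} (hf : f ∈ maximalIdeal R ^ i)
    (hf' : f ∉ maximalIdeal R ^ (i + 1)) (hg : g ∈ maximalIdeal R ^ j)
    (hg' : g ∉ maximalIdeal R ^ (j + 1)) : f * g ∉ maximalIdeal R ^ (i + j + 1) := by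
  obtain ⟨d, x, hx, hd⟩ := exists_parameters R
  obtain ⟨F, hF⟩ := IsLeadingForm.exists_of_mem hx hf
  obtain ⟨G, hG⟩ := IsLeadingForm.exists_of_mem hx hg
  intro h
  rcases mul_eq_zero.1 ((hF.mul hx hG).eq_zero hx hd h) with rfl | rfl
  · exact hf' (hF.mem_succ hx)
  · exact hg' (hG.mem_succ hx)

theorem exists_notMem_pow_succ {f : R} (hf : f ≠ 0) :
    ∃ n, f ∈ maximalIdeal R ^ n ∧ f ∉ maximalIdeal R ^ (n + 1) := by
  classical
  have hex : ∃ n, f ∉ maximalIdeal R ^ n := by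
    by_contra! hall
    have : f ∈ ⨅ n : ℕ, maximalIdeal R ^ n := by simpa [Ideal.mem_iInf] using hall
    rw [Ideal.iInf_pow_eq_bot_of_isLocalRing _ (maximalIdeal.isMaximal R).ne_top] at this
    exact hf this
  obtain ⟨n, hn⟩ : ∃ n, Nat.find hex = n + 1 :=
    Nat.exists_eq_succ_of_ne_zero fun h0 => by
      have := Nat.find_spec hex
      rw [h0] at this
      simp at this
  exact ⟨n, by_contra fun h => Nat.find_min hex (m := n) (by omega) h, hn ▸ Nat.find_spec hex⟩

/-- A regular local domain is integrally closed. -/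
theorem isIntegrallyClosed [IsDomain R] : IsIntegrallyClosed R := by
  obtain ⟨d, x, hx, hd⟩ := exists_parameters R
  let K := FractionRing R
  let κ := ResidueField R
  refine (isIntegrallyClosed_iff K).2 fun {z} hz => ?_
  obtain ⟨f, h, hh, rfl⟩ := IsFractionRing.div_surjective (A := R) z
  have hh0 : h ≠ 0 := nonZeroDivisors.ne_zero hh
  have hhK : algebraMap R K h ≠ 0 := by simpa using hh0
  obtain ⟨s, hs, hs'⟩ := exists_notMem_pow_succ hh0
  obtain ⟨H, hH⟩ := IsLeadingForm.exists_of_mem hx hs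
  have hH0 : H ≠ 0 := by rintro rfl; exact hs' (hH.mem_succ hx)
  -- Successive approximation: the leading form of the remainder is divisible by that of `h`, and
  -- subtracting `h` times a lift of the quotient raises the order of the remainder.
  have key : ∀ N, ∃ q, f - h * q ∈ maximalIdeal R ^ N := by
    intro N
    induction N with
    | zero => exact ⟨0, by simp⟩
    | succ N ih =>
      obtain ⟨q, hq⟩ := ih
      obtain ⟨F, hF⟩ := IsLeadingForm.exists_of_mem hx hq
      by_cases hF0 : F = 0
      · subst hF0; exact ⟨q, hF.mem_succ hx⟩
      have hz' : IsIntegral R (algebraMap R K (f - h * q) / algebraMap R K h) := by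
        have : algebraMap R K (f - h * q) / algebraMap R K h
            = algebraMap R K f / algebraMap R K h - algebraMap R K q := by
          rw [map_sub, map_mul, sub_div, mul_div_cancel_left₀ _ hhK]
        rw [this]
        exact hz.sub isIntegral_algebraMap
      obtain ⟨c, hc, hck⟩ := hz'.isAlmostIntegral
      obtain ⟨t, ht, ht'⟩ := exists_notMem_pow_succ (nonZeroDivisors.ne_zero hc)
      obtain ⟨C, hC⟩ := IsLeadingForm.exists_of_mem hx ht
      have hC0 : C ≠ 0 := by rintro rfl; exact ht' (hC.mem_succ hx)
      -- Compare leading forms in `c * (f - h * q) ^ k = h ^ k * w`. Both sides have nonzero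
      -- products of forms, so the degrees agree.
      have hdvd : ∀ k, H ^ k ∣ C * F ^ k := by
        intro k
        obtain ⟨w, hw⟩ := hck k
        have hw' : c * (f - h * q) ^ k = h ^ k * w := by
          apply IsFractionRing.injective R K
          rw [Algebra.smul_def, div_pow] at hw
          rw [map_mul, map_mul, map_pow, map_pow, hw, ← mul_div_assoc,
            mul_div_cancel₀ _ (pow_ne_zero k hhK)]
        have hL := hC.mul hx (hF.pow hx k)
        have hw0 : w ≠ 0 := by
          rintro rfl
          rw [hw', mul_zero] at hL
          exact mul_ne_zero hC0 (pow_ne_zero k hF0) (hL.eq_zero hx hd (zero_mem _))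
        obtain ⟨v, hv, hv'⟩ := exists_notMem_pow_succ hw0
        obtain ⟨W, hW⟩ := IsLeadingForm.exists_of_mem hx hv
        have hW0 : W ≠ 0 := by rintro rfl; exact hv' (hW.mem_succ hx)
        have hR := (hH.pow hx k).mul hx hW
        rw [← hw'] at hR
        have heq : s * k + v = t + N * k := by
          rcases lt_trichotomy (s * k + v) (t + N * k) with hlt | heq | hlt
          · exact absurd (hR.eq_zero hx hd (Ideal.pow_le_pow_right hlt (hL.mem hx)))
              (mul_ne_zero (pow_ne_zero k hH0) hW0)
          · exact heq
          · exact absurd (hL.eq_zero hx hd (Ideal.pow_le_pow_right hlt (hR.mem hx)))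
              (mul_ne_zero hC0 (pow_ne_zero k hF0))
        rw [heq] at hR
        exact ⟨W, hL.unique hx hd hR⟩
      -- `F / H` is almost integral over a polynomial ring over a field, which is Noetherian and
      -- integrally closed.
      have hHF : H ∣ F := by
        let A := MvPolynomial (Fin d) κ
        let L := FractionRing A
        have hHL : algebraMap A L H ≠ 0 := by simpa using hH0
        have h1 : IsAlmostIntegral A (algebraMap A L F / algebraMap A L H) := by
          refine ⟨C, mem_nonZeroDivisors_of_ne_zero hC0, fun k => ?_⟩
          obtain ⟨W, hW⟩ := hdvd k
          refine ⟨W, ?_⟩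
          rw [Algebra.smul_def, div_pow, ← mul_div_assoc, eq_div_iff (pow_ne_zero k hHL),
            ← map_pow, ← map_pow, ← map_mul, ← map_mul, hW, mul_comm]
        obtain ⟨G, hG⟩ := (isIntegrallyClosed_iff L).1 inferInstance h1.isIntegral
        refine ⟨G, IsFractionRing.injective A L ?_⟩
        rw [map_mul, hG, mul_div_cancel₀ _ hHL]
      obtain ⟨e, rfl, G, hG, hFG⟩ :=
        hF.isHomogeneous.exists_homogeneous_of_dvd hH.isHomogeneous hHF hF0
      obtain ⟨q', hq'⟩ := IsLeadingForm.exists_of_isHomogeneous x hG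
      refine ⟨q + q', ?_⟩
      have := hF.sub (hH.mul hx hq')
      rw [← hFG, sub_self] at this
      convert this.mem_succ hx using 1
      ring
  -- `f` lies in `(h) + 𝔪ᴺ` for all `N`; apply Krull's intersection theorem in `R/(h)`.
  have hmem : f ∈ Ideal.span {h} := by
    by_cases hu : Ideal.span {h} = ⊤
    · rw [hu]; trivial
    rw [← Ideal.Quotient.eq_zero_iff_mem]
    have hloc : IsLocalRing (R ⧸ Ideal.span {h}) := by
      have := Ideal.Quotient.nontrivial_iff.2 hu
      exact IsLocalRing.of_surjective' _ Ideal.Quotient.mk_surjective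
    have hkr := Ideal.iInf_pow_eq_bot_of_isLocalRing (maximalIdeal (R ⧸ Ideal.span {h}))
      (maximalIdeal.isMaximal _).ne_top
    rw [← Ideal.mem_bot, ← hkr, Ideal.mem_iInf]
    intro N
    obtain ⟨q, hq⟩ := key N
    have h1 : Ideal.Quotient.mk (Ideal.span {h}) f
        = Ideal.Quotient.mk (Ideal.span {h}) (f - h * q) := by
      rw [Ideal.Quotient.eq, sub_sub_cancel]
      exact Ideal.mul_mem_right _ _ (Ideal.mem_span_singleton_self h)
    rw [h1]
    have h2 : (maximalIdeal R).map (Ideal.Quotient.mk (Ideal.span {h})) ≤ maximalIdeal _ := by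
      have : IsLocalHom (Ideal.Quotient.mk (Ideal.span {h})) :=
        IsLocalHom.of_surjective _ Ideal.Quotient.mk_surjective
      exact ((local_hom_TFAE (Ideal.Quotient.mk (Ideal.span {h}))).out 0 2 :).1 this
    exact Ideal.pow_right_mono h2 N (Ideal.map_pow (Ideal.Quotient.mk (Ideal.span {h})) (maximalIdeal R) N ▸
      Ideal.mem_map_of_mem _ hq)
  obtain ⟨y, rfl⟩ := Ideal.mem_span_singleton'.1 hmem
  exact ⟨y, by rw [map_mul, mul_div_cancel_right₀ _ hhK]⟩

end IsRegularLocalRing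

/-! ### The order valuation. -/

namespace IsRegularLocalRing

open WithZero

variable (R : Type*) [CommRing R] [IsRegularLocalRing R]

/-- The order of a nonzero element of a regular local ring, and `0` for the element `0`. -/
def orderNat (f : R) : ℕ :=
  open Classical in if hf : f = 0 then 0 else (exists_notMem_pow_succ hf).choose

variable {R}

theorem mem_pow_iff_le_orderNat {f : R} (hf : f ≠ 0) {n : ℕ} :
    f ∈ maximalIdeal R ^ n ↔ n ≤ orderNat R f := by
  rw [orderNat, dif_neg hf]
  have h := (exists_notMem_pow_succ hf).choose_spec
  refine ⟨fun hn => ?_, fun hn => Ideal.pow_le_pow_right hn h.1⟩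
  by_contra hlt
  exact h.2 (Ideal.pow_le_pow_right (by omega) hn)

theorem orderNat_mul [IsDomain R] {f g : R} (hf : f ≠ 0) (hg : g ≠ 0) :
    orderNat R (f * g) = orderNat R f + orderNat R g := by
  have h (f : R) (hf : f ≠ 0) : f ∈ maximalIdeal R ^ orderNat R f ∧
      f ∉ maximalIdeal R ^ (orderNat R f + 1) := by
    simp [mem_pow_iff_le_orderNat hf]
  apply le_antisymm
  · have := mul_notMem_pow (h f hf).1 (h f hf).2 (h g hg).1 (h g hg).2
    rw [mem_pow_iff_le_orderNat (mul_ne_zero hf hg)] at this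
    omega
  · rw [← mem_pow_iff_le_orderNat (mul_ne_zero hf hg), pow_add]
    exact Ideal.mul_mem_mul (h f hf).1 (h g hg).1

variable (R) in
/-- The order valuation of a regular local domain. -/
def orderValuation [IsDomain R] : Valuation R ℤᵐ⁰ where
  toFun f := open Classical in if f = 0 then 0 else exp (-(orderNat R f : ℤ))
  map_zero' := by simp
  map_one' := by
    rw [if_neg one_ne_zero, ← exp_zero, exp_inj, neg_eq_zero, Nat.cast_eq_zero]
    by_contra h
    have := (mem_pow_iff_le_orderNat (R := R) one_ne_zero (n := 1)).2 (Nat.one_le_iff_ne_zero.2 h)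
    rw [pow_one] at this
    exact (Ideal.ne_top_iff_one _).1 (maximalIdeal.isMaximal R).ne_top this
  map_mul' f g := by
    by_cases hf : f = 0
    · simp [hf]
    by_cases hg : g = 0
    · simp [hg]
    rw [if_neg hf, if_neg hg, if_neg (mul_ne_zero hf hg), orderNat_mul hf hg, ← exp_add]
    congr 1
    push_cast
    ring
  map_add_le_max' f g := by
    by_cases hfg : f + g = 0
    · simp [hfg]
    by_cases hf : f = 0
    · subst hf
      rw [if_neg hfg, if_neg (by simpa using hfg : g ≠ 0), zero_add]
      exact le_max_right _ _
    by_cases hg : g = 0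
    · subst hg
      rw [if_neg hfg, if_neg hf, add_zero]
      exact le_max_left _ _
    rw [if_neg hf, if_neg hg, if_neg hfg, le_max_iff, exp_le_exp, exp_le_exp, neg_le_neg_iff,
      neg_le_neg_iff, Nat.cast_le, Nat.cast_le, ← min_le_iff]
    rw [← mem_pow_iff_le_orderNat hfg]
    exact add_mem ((mem_pow_iff_le_orderNat hf).2 (min_le_left _ _))
      ((mem_pow_iff_le_orderNat hg).2 (min_le_right _ _))

theorem orderValuation_apply [IsDomain R] {f : R} (hf : f ≠ 0) :
    orderValuation R f = exp (-(orderNat R f : ℤ)) := if_neg hf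

theorem orderValuation_le_iff [IsDomain R] {f : R} {n : ℕ} :
    orderValuation R f ≤ exp (-(n : ℤ)) ↔ f ∈ maximalIdeal R ^ n := by
  by_cases hf : f = 0
  · simp [hf]
  · rw [orderValuation_apply hf, exp_le_exp, neg_le_neg_iff, Nat.cast_le, mem_pow_iff_le_orderNat hf]

open scoped nonZeroDivisors in
theorem nonZeroDivisors_le_primeCompl_supp [IsDomain R] :
    R⁰ ≤ (orderValuation R).supp.primeCompl := by
  intro f hf h
  have h' : orderValuation R f = 0 := h
  rw [orderValuation_apply (nonZeroDivisors.ne_zero hf)] at h'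
  exact exp_ne_zero h'

variable (R) in
/-- The order valuation on the fraction field of a regular local domain. -/
def ordVal (K : Type*) [IsDomain R] [Field K] [Algebra R K] [IsFractionRing R K] :
    Valuation K ℤᵐ⁰ :=
  (orderValuation R).extendToLocalization nonZeroDivisors_le_primeCompl_supp K

section

variable [IsDomain R] {K : Type*} [Field K] [Algebra R K] [IsFractionRing R K]

theorem ordVal_algebraMap_le_iff {f : R} {n : ℕ} :
    ordVal R K (algebraMap R K f) ≤ exp (-(n : ℤ)) ↔ f ∈ maximalIdeal R ^ n := by
  rw [ordVal, Valuation.extendToLocalization_apply_map_apply, orderValuation_le_iff]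

theorem ordVal_algebraMap_eq {f : R} {n : ℕ} (h : f ∈ maximalIdeal R ^ n)
    (h' : f ∉ maximalIdeal R ^ (n + 1)) : ordVal R K (algebraMap R K f) = exp (-(n : ℤ)) := by
  refine le_antisymm (ordVal_algebraMap_le_iff.2 h) ?_
  by_contra hlt
  rw [not_le] at hlt
  refine h' (ordVal_algebraMap_le_iff (K := K).1 ?_)
  have h0 : ordVal R K (algebraMap R K f) ≠ 0 := by
    rw [Valuation.ne_zero_iff]
    intro h0
    rw [(IsFractionRing.injective R K).eq_iff' (map_zero _)] at h0
    exact h' (h0 ▸ zero_mem _)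
  rw [← exp_log h0, exp_lt_exp] at hlt
  rw [← exp_log h0, exp_le_exp]
  push_cast
  omega

theorem ord_le_ord_iff {f g : R} (hg : g ≠ 0) :
    BirationalModel.ord g ≤ BirationalModel.ord f ↔
      ordVal R K (algebraMap R K f) ≤ ordVal R K (algebraMap R K g) := by
  obtain ⟨n, hn, hn'⟩ := exists_notMem_pow_succ hg
  have h1 : BirationalModel.ord g = n := by
    refine le_antisymm (iSup₂_le fun m hm => ?_) (le_iSup₂_of_le n hn le_rfl)
    by_contra hlt
    exact hn' (Ideal.pow_le_pow_right (by exact_mod_cast not_le.1 hlt) hm)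
  rw [ordVal_algebraMap_eq hn hn', ordVal_algebraMap_le_iff, h1]
  refine ⟨fun h => ?_, fun h => le_iSup₂_of_le n h le_rfl⟩
  by_contra hf
  have : BirationalModel.ord f < n := by
    obtain _ | n := n
    · simp at hf
    refine lt_of_le_of_lt (b := (n : ℕ∞)) (iSup₂_le fun m hm => ?_) (by exact_mod_cast n.lt_succ_self)
    by_contra hlt
    exact hf (Ideal.pow_le_pow_right (by exact_mod_cast not_le.1 hlt) hm)
  exact absurd h (not_le.2 this)

theorem mem_ordValuationRing_iff {z : K} :
    z ∈ BirationalModel.ordValuationRing R K ↔ ordVal R K z ≤ 1 := by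
  have h (f g : R) (hg : g ≠ 0) : BirationalModel.ord g ≤ BirationalModel.ord f ↔
      ordVal R K (algebraMap R K f / algebraMap R K g) ≤ 1 := by
    have h0 : ordVal R K (algebraMap R K g) ≠ 0 := by
      rw [Valuation.ne_zero_iff]
      simpa using hg
    rw [ord_le_ord_iff (K := K) hg, map_div₀, div_le_one₀ (zero_lt_iff.2 h0)]
  constructor
  · rintro ⟨f, g, hg, hle, rfl⟩
    exact (h f g hg).1 hle
  · intro hz
    obtain ⟨f, g, hg, rfl⟩ := IsFractionRing.div_surjective (A := R) z
    have hg := nonZeroDivisors.ne_zero hg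
    exact ⟨f, g, hg, (h f g hg).2 hz, rfl⟩

end

end IsRegularLocalRing

/-! ### Integrality, localizations, centers and charts inside `K`. -/

namespace BirationalModel

section

variable {R K : Type*} [CommRing R] [Field K] [Algebra R K]

theorem exists_common_mul_mem {A C : Subalgebra R K} {M : Submonoid K} (hM : ∀ c ∈ M, c ∈ A)
    (hC : ∀ z ∈ C, ∃ c ∈ M, c * z ∈ A) (s : Finset K) (hs : ∀ z ∈ s, z ∈ C) :
    ∃ c ∈ M, ∀ z ∈ s, c * z ∈ A := by
  classical
  induction s using Finset.induction_on with
  | empty => exact ⟨1, M.one_mem, by simp⟩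
  | insert a s _ ih =>
    obtain ⟨c, hc, h⟩ := ih fun z hz => hs z (Finset.mem_insert_of_mem hz)
    obtain ⟨c', hc', h'⟩ := hC a (hs a (Finset.mem_insert_self _ _))
    refine ⟨c * c', M.mul_mem hc hc', fun z hz => ?_⟩
    rcases Finset.mem_insert.1 hz with rfl | hz
    · rw [mul_assoc]; exact A.mul_mem (hM c hc) h'
    · rw [mul_comm c, mul_assoc]; exact A.mul_mem (hM c' hc') (h z hz)

/-- If `A` is integrally closed in `K` and every element of `C` becomes an element of `A` after
multiplication by an element of the multiplicative set `M ⊆ A`, then so does every element of `K`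
integral over `C`. -/
theorem exists_mul_mem_of_isIntegral {A C : Subalgebra R K} {M : Submonoid K}
    (hA : ∀ z : K, IsIntegral A z → z ∈ A) (hM : ∀ c ∈ M, c ∈ A)
    (hC : ∀ z ∈ C, ∃ c ∈ M, c * z ∈ A) {z : K} (hz : IsIntegral C z) :
    ∃ c ∈ M, c * z ∈ A := by
  classical
  obtain ⟨p, hp, hpz⟩ := hz
  set q : Polynomial K := p.map (algebraMap C K) with hq
  have hqm : q.Monic := hp.map _
  have hqz : q.eval z = 0 := by rw [hq, Polynomial.eval_map]; exact hpz
  obtain ⟨c, hc, h⟩ := exists_common_mul_mem hM hC (q.support.image q.coeff) (by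
    intro w hw
    obtain ⟨i, -, rfl⟩ := Finset.mem_image.1 hw
    rw [hq, Polynomial.coeff_map]
    exact (p.coeff i).2)
  refine ⟨c, hc, hA _ ?_⟩
  -- The coefficient of index `i` is multiplied by `c ^ (natDegree - i)`, so each nonleading one
  -- receives at least one factor `c`, which brings it into `A`.
  have hlift : q.scaleRoots c ∈ Polynomial.lifts (algebraMap A K) := by
    rw [Polynomial.lifts_iff_coeff_lifts]
    intro i
    rw [Polynomial.coeff_scaleRoots]
    rcases lt_trichotomy i q.natDegree with hi | hi | hi
    · obtain ⟨e, he⟩ := Nat.exists_eq_add_of_lt hi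
      have h1 : q.coeff i * c ^ (q.natDegree - i) = (c * q.coeff i) * c ^ e := by
        rw [he, show i + e + 1 - i = e + 1 by omega]; ring
      rw [h1]
      by_cases h0 : q.coeff i = 0
      · rw [h0]; exact ⟨0, by simp⟩
      refine ⟨⟨_, A.mul_mem (h _ (Finset.mem_image.2 ⟨i, by simpa using h0, rfl⟩))
        (A.pow_mem (hM c hc) e)⟩, rfl⟩
    · rw [hi, hqm.coeff_natDegree]
      exact ⟨1, by simp⟩
    · rw [Polynomial.coeff_eq_zero_of_natDegree_lt hi]
      exact ⟨0, by simp⟩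
  have hmon : (q.scaleRoots c).Monic := (Polynomial.monic_scaleRoots_iff c).2 hqm
  obtain ⟨r, hr, -, hrm⟩ := Polynomial.lifts_and_natDegree_eq_and_monic hlift hmon
  refine ⟨r, hrm, ?_⟩
  rw [← Polynomial.eval_map, hr]
  have := Polynomial.scaleRoots_aeval_eq_zero (A := K) (p := q) (a := z) (r := c) hqz
  exact this

/-- Being integral is monotone in the subalgebra. -/
theorem isIntegral_of_le {A B : Subalgebra R K} (h : A ≤ B) {z : K} (hz : IsIntegral A z) :
    IsIntegral B z :=
  RingHom.IsIntegralElem.of_comp (f := (Subalgebra.inclusion h).toRingHom) (g := algebraMap B K) hz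

theorem valuation_le_one_of_isIntegral {Γ : Type*} [LinearOrderedCommGroupWithZero Γ]
    {v : Valuation K Γ} {B : Subalgebra R K} (hB : ∀ z ∈ B, v z ≤ 1) {z : K}
    (hz : IsIntegral B z) : v z ≤ 1 := by
  have h1 : IsIntegral v.integer z :=
    RingHom.IsIntegralElem.of_comp
      (f := ((algebraMap B K).codRestrict v.integer fun b => hB b b.2))
      (g := algebraMap v.integer K) hz
  exact (Valuation.integer.integers v).mem_of_integral h1

/-! ### Localizations at primes -/

section LocalizationAt

theorem coe_ne_zero_of_notMem {B : Subalgebra R K} {P : Ideal B} {c : B} (hc : c ∉ P) :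
    (c : K) ≠ 0 := fun h0 =>
  hc (by rw [show c = 0 from Subtype.ext h0]; exact P.zero_mem)

variable (B : Subalgebra R K) (P : Ideal B) [hP : P.IsPrime]

theorem le_localizationAt : B ≤ localizationAt B P := fun z hz =>
  ⟨⟨z, hz⟩, 1, fun h => hP.ne_top ((Ideal.eq_top_iff_one P).2 h), by simp⟩

variable {B P}

theorem inv_mem_localizationAt {c : B} (hc : c ∉ P) : (c : K)⁻¹ ∈ localizationAt B P :=
  ⟨1, c, hc, by simp⟩

theorem isUnit_iff_inv_mem {S : Subalgebra R K} {z : S} : IsUnit z ↔ (z : K) ≠ 0 ∧ (z : K)⁻¹ ∈ S := by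
  constructor
  · rintro ⟨u, rfl⟩
    have h : ((u : S) : K) * ((u⁻¹ : Sˣ) : S) = 1 := by
      rw [← MulMemClass.coe_mul, Units.mul_inv, OneMemClass.coe_one]
    refine ⟨left_ne_zero_of_mul_eq_one h, ?_⟩
    rw [inv_eq_of_mul_eq_one_right h]
    exact SetLike.coe_mem _
  · rintro ⟨h0, h⟩
    exact IsUnit.of_mul_eq_one ⟨_, h⟩ (Subtype.ext (mul_inv_cancel₀ h0))

instance isLocalRing_localizationAt : IsLocalRing (localizationAt B P) := by
  refine ⟨fun {y z} h => ?_⟩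
  obtain ⟨_, b, c, hc, rfl⟩ := y
  obtain ⟨_, b', c', hc', rfl⟩ := z
  have h0 := coe_ne_zero_of_notMem hc
  have h0' := coe_ne_zero_of_notMem hc'
  have h1 : (b : K) / c + (b' : K) / c' = 1 := congrArg Subtype.val h
  have h2 : b * c' + c * b' = c * c' := by
    apply Subtype.ext
    push_cast
    rw [div_add_div _ _ h0 h0', div_eq_one_iff_eq (mul_ne_zero h0 h0')] at h1
    exact h1
  have key (b c : B) (hc : c ∉ P) (hb : b ∉ P) (hm : (b : K) / c ∈ localizationAt B P) :
      IsUnit (⟨(b : K) / c, hm⟩ : localizationAt B P) :=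
    isUnit_iff_inv_mem.2 ⟨div_ne_zero (coe_ne_zero_of_notMem hb) (coe_ne_zero_of_notMem hc),
      ⟨c, b, hb, inv_div _ _⟩⟩
  by_cases hb : b ∈ P
  · right
    refine key b' c' hc' (fun hb' => ?_) _
    have : c * c' ∈ P := h2 ▸ P.add_mem (P.mul_mem_right _ hb) (P.mul_mem_left _ hb')
    exact (hP.mem_or_mem this).elim hc hc'
  · exact Or.inl (key b c hc hb _)

theorem mem_localizationAt_of_isIntegral (hB : ∀ z : K, IsIntegral B z → z ∈ B) {z : K}
    (hz : IsIntegral (localizationAt B P) z) : z ∈ localizationAt B P := by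
  let M : Submonoid K := P.primeCompl.map (B.val : B →* K)
  obtain ⟨_, ⟨c, hc, rfl⟩, h⟩ := exists_mul_mem_of_isIntegral (M := M) hB
    (by rintro _ ⟨c, -, rfl⟩; exact c.2) (by
      rintro _ ⟨b, c, hc, rfl⟩
      refine ⟨c, ⟨c, hc, rfl⟩, ?_⟩
      rw [mul_div_cancel₀ _ (coe_ne_zero_of_notMem hc)]
      exact b.2) hz
  refine ⟨⟨_, h⟩, c, hc, ?_⟩
  exact (mul_div_cancel_left₀ z (coe_ne_zero_of_notMem hc)).symm

end LocalizationAt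

/-! ### Centers of valuations -/

section Center

variable {Γ : Type*} [LinearOrderedCommGroupWithZero Γ] (v : Valuation K Γ) (B : Subalgebra R K)

/-- The center on `B` of a valuation that is at most `1` on `B`. -/
def center (hB : ∀ z ∈ B, v z ≤ 1) : Ideal B where
  carrier := {b | v b < 1}
  zero_mem' := by simp
  add_mem' {a b} ha hb := (v.map_add _ _).trans_lt (max_lt ha hb)
  smul_mem' a b hb := by
    change v (a * b : K) < 1
    rw [map_mul]
    exact mul_lt_one_of_nonneg_of_lt_one_right (hB a a.2) zero_le hb

variable {v B} {hB : ∀ z ∈ B, v z ≤ 1}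

theorem mem_center {b : B} : b ∈ center v B hB ↔ v b < 1 := Iff.rfl

theorem notMem_center {b : B} : b ∉ center v B hB ↔ v b = 1 := by
  rw [mem_center, not_lt]
  exact ⟨fun h => le_antisymm (hB b b.2) h, fun h => h.ge⟩

instance center_isPrime : (center v B hB).IsPrime where
  ne_top' h := by
    have := (Ideal.eq_top_iff_one _).1 h
    rw [mem_center] at this
    simp at this
  mem_or_mem' {a b} h := by
    by_contra! hab
    rw [notMem_center, notMem_center] at hab
    rw [mem_center] at h
    simp [hab.1, hab.2] at h

theorem mem_localizationAt_center {z : K} :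
    z ∈ localizationAt B (center v B hB) ↔ ∃ b ∈ B, ∃ c ∈ B, v c = 1 ∧ z = b / c := by
  constructor
  · rintro ⟨b, c, hc, rfl⟩
    exact ⟨b, b.2, c, c.2, notMem_center.1 hc, rfl⟩
  · rintro ⟨b, hb, c, hc, hv, rfl⟩
    exact ⟨⟨b, hb⟩, ⟨c, hc⟩, notMem_center.2 hv, rfl⟩

theorem valuation_le_one_of_mem_localizationAt {z : K}
    (hz : z ∈ localizationAt B (center v B hB)) : v z ≤ 1 := by
  obtain ⟨b, hb, c, hc, hv, rfl⟩ := mem_localizationAt_center.1 hz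
  rw [map_div₀, hv, div_one]
  exact hB b hb

theorem inv_mem_localizationAt_center {z : K} (hz : z ∈ localizationAt B (center v B hB))
    (h1 : v z = 1) : z⁻¹ ∈ localizationAt B (center v B hB) := by
  obtain ⟨b, hb, c, hc, hv, rfl⟩ := mem_localizationAt_center.1 hz
  refine mem_localizationAt_center.2 ⟨c, hc, b, hb, ?_, inv_div _ _⟩
  rwa [map_div₀, hv, div_one] at h1

end Center

/-! ### Charts -/

theorem mem_blowupChart {I : Ideal R} {a : R} (ha : a ∈ I) (ha0 : algebraMap R K a ≠ 0) {z : K} :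
    z ∈ blowupChart K I a ↔ ∃ k, ∃ f ∈ I ^ k, z = algebraMap R K f / algebraMap R K a ^ k := by
  constructor
  · intro hz
    induction hz using Algebra.adjoin_induction with
    | mem x hx =>
      obtain ⟨b, hb, rfl⟩ := hx
      exact ⟨1, b, by simpa using hb, by simp⟩
    | algebraMap r => exact ⟨0, r, by simp, by simp⟩
    | add x y _ _ hx hy =>
      obtain ⟨k, f, hf, rfl⟩ := hx
      obtain ⟨l, g, hg, rfl⟩ := hy
      refine ⟨k + l, f * a ^ l + a ^ k * g, add_mem ?_ ?_, ?_⟩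
      · rw [pow_add]; exact Ideal.mul_mem_mul hf (Ideal.pow_mem_pow ha l)
      · rw [pow_add]; exact Ideal.mul_mem_mul (Ideal.pow_mem_pow ha k) hg
      · rw [div_add_div _ _ (pow_ne_zero k ha0) (pow_ne_zero l ha0), pow_add]
        simp
    | mul x y _ _ hx hy =>
      obtain ⟨k, f, hf, rfl⟩ := hx
      obtain ⟨l, g, hg, rfl⟩ := hy
      refine ⟨k + l, f * g, pow_add I k l ▸ Ideal.mul_mem_mul hf hg, ?_⟩
      rw [div_mul_div_comm, map_mul, pow_add]
  · rintro ⟨k, f, hf, rfl⟩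
    induction k generalizing f with
    | zero => simp
    | succ k ih =>
      rw [pow_succ] at hf
      refine Submodule.mul_induction_on hf (fun m hm n hn => ?_) fun m n hm hn => ?_
      · rw [map_mul, pow_succ, ← div_mul_div_comm]
        exact mul_mem (ih m hm) (Algebra.subset_adjoin ⟨n, hn, rfl⟩)
      · rw [map_add, add_div]; exact add_mem hm hn

theorem blowupChart_le_iff {I : Ideal R} {a : R} {S : Subalgebra R K} :
    blowupChart K I a ≤ S ↔ ∀ b ∈ I, algebraMap R K b / algebraMap R K a ∈ S := by
  rw [blowupChart, Algebra.adjoin_le_iff]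
  constructor
  · exact fun h b hb => h ⟨b, hb, rfl⟩
  · rintro h _ ⟨b, hb, rfl⟩
    exact h b hb

theorem mem_normalizedBlowupChart {I : Ideal R} {a : R} {z : K} :
    z ∈ normalizedBlowupChart K I a ↔ IsIntegral (blowupChart K I a) z := Iff.rfl

theorem blowupChart_le_normalizedBlowupChart (I : Ideal R) (a : R) :
    blowupChart K I a ≤ normalizedBlowupChart K I a := fun z hz =>
  mem_normalizedBlowupChart.2 (isIntegral_algebraMap (x := (⟨z, hz⟩ : blowupChart K I a)))

theorem mem_normalizedBlowupChart_of_isIntegral {I : Ideal R} {a : R} {z : K}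
    (hz : IsIntegral (normalizedBlowupChart K I a) z) : z ∈ normalizedBlowupChart K I a := by
  have : IsIntegral (integralClosure (blowupChart K I a) K) z := hz
  exact mem_normalizedBlowupChart.2 (isIntegral_trans z this)

theorem normalizedBlowupChart_le {I : Ideal R} {a : R} {S : Subalgebra R K}
    (hS : ∀ z : K, IsIntegral S z → z ∈ S)
    (h : ∀ b ∈ I, algebraMap R K b / algebraMap R K a ∈ S) : normalizedBlowupChart K I a ≤ S :=
  fun z hz => hS z (isIntegral_of_le (blowupChart_le_iff.2 h) (mem_normalizedBlowupChart.1 hz))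

end

end BirationalModel

/-! ### Principal extensions of powers of `𝔪` and homogeneous prime avoidance. -/

namespace BirationalModel

section

variable {R K : Type*} [CommRing R] [Field K] [Algebra R K]

/-- `F ∈ 𝔪ᵉ` is nonzero and generates the extension of `𝔪ᵉ` to `T`. -/
def GeneratesPow (m : Ideal R) (T : Subalgebra R K) (e : ℕ) (F : R) : Prop :=
  algebraMap R K F ≠ 0 ∧ F ∈ m ^ e ∧ ∀ y ∈ m ^ e, algebraMap R K y / algebraMap R K F ∈ T

namespace GeneratesPow

variable {m : Ideal R} {T : Subalgebra R K}

theorem mul {e e' : ℕ} {F F' : R} (h : GeneratesPow m T e F) (h' : GeneratesPow m T e' F') :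
    GeneratesPow m T (e + e') (F * F') := by
  refine ⟨by rw [map_mul]; exact mul_ne_zero h.1 h'.1, pow_add m e e' ▸
    Ideal.mul_mem_mul h.2.1 h'.2.1, fun y hy => ?_⟩
  rw [pow_add] at hy
  refine Submodule.mul_induction_on hy (fun a ha b hb => ?_) fun a b ha hb => ?_
  · rw [map_mul, map_mul, ← div_mul_div_comm]
    exact T.mul_mem (h.2.2 a ha) (h'.2.2 b hb)
  · rw [map_add, add_div]; exact T.add_mem ha hb

/-- Cancel `F'` in `yF'/(FF') ∈ T`. Used contrapositively: a product fails to generate as soon as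
one of its factors does. -/
theorem of_mul_left {e e' : ℕ} {F F' : R} (hF : F ∈ m ^ e) (hF' : F' ∈ m ^ e')
    (h : GeneratesPow m T (e + e') (F * F')) : GeneratesPow m T e F := by
  obtain ⟨h0, -, h⟩ := h
  rw [map_mul] at h0
  refine ⟨left_ne_zero_of_mul h0, hF, fun y hy => ?_⟩
  have := h (y * F') (pow_add m e e' ▸ Ideal.mul_mem_mul hy hF')
  rwa [map_mul, map_mul, mul_div_mul_right _ _ (right_ne_zero_of_mul h0)] at this

theorem one : GeneratesPow m T 0 1 := by
  refine ⟨by simp, by simp, fun y _ => ?_⟩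
  rw [map_one, div_one]
  exact T.algebraMap_mem y

theorem pow {e : ℕ} {F : R} (h : GeneratesPow m T e F) (k : ℕ) :
    GeneratesPow m T (k * e) (F ^ k) := by
  induction k with
  | zero => simpa using one
  | succ k ih => rw [pow_succ, Nat.succ_mul]; exact ih.mul h

theorem of_pow {e k : ℕ} {F : R} (hF : F ∈ m ^ e) (hk : 0 < k)
    (h : GeneratesPow m T (k * e) (F ^ k)) : GeneratesPow m T e F := by
  obtain ⟨k, rfl⟩ := Nat.exists_eq_succ_of_ne_zero hk.ne'
  rw [pow_succ', Nat.succ_mul, add_comm] at h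
  refine of_mul_left hF ?_ h
  rw [mul_comm, pow_mul]
  exact Ideal.pow_mem_pow hF k

/-- `G/F` is a nonunit of `T`, so `1 + G/F` is a unit of the local ring `T`. -/
theorem add_of_not [IsLocalRing T] {e : ℕ} {F G : R} (h : GeneratesPow m T e F)
    (hG : G ∈ m ^ e) (hn : ¬ GeneratesPow m T e G) : GeneratesPow m T e (F + G) := by
  obtain ⟨h0, hF, h⟩ := h
  set w : T := ⟨_, h G hG⟩ with hw
  have hGw : algebraMap R K G = algebraMap R K F * w := (mul_div_cancel₀ _ h0).symm
  have hwn : ¬ IsUnit (-w) := by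
    rw [IsUnit.neg_iff, isUnit_iff_inv_mem]
    rintro ⟨hw0, hwi⟩
    refine hn ⟨by rw [hGw]; exact mul_ne_zero h0 hw0, hG, fun y hy => ?_⟩
    rw [hGw, ← div_div, div_eq_mul_inv]
    exact T.mul_mem (h y hy) hwi
  have hu : IsUnit (1 + w) :=
    (isUnit_or_isUnit_of_add_one (a := -w) (b := 1 + w) (by ring)).resolve_left hwn
  obtain ⟨hu0, hui⟩ := isUnit_iff_inv_mem.1 hu
  have hFG : algebraMap R K (F + G) = algebraMap R K F * (1 + w : T) := by
    rw [map_add, hGw]; push_cast; ring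
  refine ⟨by rw [hFG]; exact mul_ne_zero h0 hu0, add_mem hF hG, fun y hy => ?_⟩
  rw [hFG, ← div_div, div_eq_mul_inv]
  exact T.mul_mem (h y hy) hui

/-- If an element generates the extension of a positive power of `𝔪` to a local ring `T`, then an
element of `𝔪` generates the extension of `𝔪`. -/
theorem isPrincipal_map [IsLocalRing T] {e : ℕ} (he : 0 < e) {F : R} (h : GeneratesPow m T e F) :
    Submodule.IsPrincipal (m.map (algebraMap R T)) := by
  obtain ⟨e, rfl⟩ := Nat.exists_eq_succ_of_ne_zero he.ne'
  obtain ⟨h0, hF, h⟩ := h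
  -- Some product `y * q` is a unit multiple of `F` in `T`; otherwise all of `𝔪ᵉ⁺¹/F`, including
  -- `F/F = 1`, would lie in the maximal ideal of `T`. Cancelling `q` then shows that its factor in
  -- `𝔪` generates.
  have hex : ∃ y ∈ m, ∃ q ∈ m ^ e, algebraMap R K (y * q) ≠ 0 ∧
      (algebraMap R K (y * q) / algebraMap R K F)⁻¹ ∈ T := by
    by_contra! hall
    have key : ∀ z ∈ m ^ (e + 1), ∃ w ∈ maximalIdeal T,
        (w : K) = algebraMap R K z / algebraMap R K F := by
      intro z hz
      have hz' := hz
      rw [pow_succ'] at hz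
      refine Submodule.mul_induction_on hz (fun y hy q hq => ?_) ?_
      · have hyq : y * q ∈ m ^ (e + 1) := pow_succ' m e ▸ Ideal.mul_mem_mul hy hq
        refine ⟨⟨_, h _ hyq⟩, ?_, rfl⟩
        rw [mem_maximalIdeal, mem_nonunits_iff, isUnit_iff_inv_mem]
        rintro ⟨h1, h2⟩
        exact hall y hy q hq (fun h3 => h1 (by simp only [h3, zero_div])) h2
      · rintro a b ⟨w, hw, hwa⟩ ⟨w', hw', hwb⟩
        exact ⟨w + w', add_mem hw hw', by rw [map_add, add_div, ← hwa, ← hwb]; rfl⟩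
    obtain ⟨w, hw, hwF⟩ := key F hF
    rw [div_self h0] at hwF
    rw [show w = 1 from Subtype.ext hwF] at hw
    exact (Ideal.ne_top_iff_one _).1 (maximalIdeal.isMaximal T).ne_top hw
  obtain ⟨x, hx, q, hq, hxq0, hxq⟩ := hex
  have hx0 : algebraMap R K x ≠ 0 := fun h => hxq0 (by rw [map_mul, h, zero_mul])
  have hq0 : algebraMap R K q ≠ 0 := fun h => hxq0 (by rw [map_mul, h, mul_zero])
  refine ⟨algebraMap R T x, le_antisymm ?_ ?_⟩
  · rw [Ideal.map_le_iff_le_comap]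
    intro y hy
    change algebraMap R T y ∈ Ideal.span {algebraMap R T x}
    rw [Ideal.mem_span_singleton']
    have h1 := T.mul_mem (h (y * q) (pow_succ' m e ▸ Ideal.mul_mem_mul hy hq)) hxq
    have h2 : algebraMap R K (y * q) / algebraMap R K F *
        (algebraMap R K (x * q) / algebraMap R K F)⁻¹ = algebraMap R K y / algebraMap R K x := by
      rw [map_mul, map_mul]; field_simp
    rw [h2] at h1
    exact ⟨⟨_, h1⟩, Subtype.ext (div_mul_cancel₀ _ hx0)⟩
  · change Ideal.span {algebraMap R T x} ≤ _
    rw [Ideal.span_singleton_le_iff_mem]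
    exact Ideal.mem_map_of_mem _ hx

theorem mem_pow_sum_prod {ι : Type*} (s : Finset ι) (e : ι → ℕ) (F : ι → R)
    (h : ∀ i ∈ s, F i ∈ m ^ e i) : ∏ i ∈ s, F i ∈ m ^ ∑ i ∈ s, e i := by
  rw [← Finset.prod_pow_eq_pow_sum]
  exact Ideal.prod_mem_prod h

theorem prod {ι : Type*} (s : Finset ι) (e : ι → ℕ) (F : ι → R)
    (h : ∀ i ∈ s, GeneratesPow m T (e i) (F i)) :
    GeneratesPow m T (∑ i ∈ s, e i) (∏ i ∈ s, F i) := by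
  classical
  induction s using Finset.induction_on with
  | empty => simpa using one
  | insert a s ha ih =>
    rw [Finset.sum_insert ha, Finset.prod_insert ha]
    exact (h a (Finset.mem_insert_self _ _)).mul
      (ih fun i hi => h i (Finset.mem_insert_of_mem hi))

/-- Homogeneous prime avoidance: if the extension of `𝔪` to each of finitely many local rings is
principal, then some element of a positive power of `𝔪` generates the extension of that power to
all of them. -/
theorem exists_forall (s : Finset (Subalgebra R K)) (hloc : ∀ T ∈ s, IsLocalRing T)
    (hm : ∀ T ∈ s, ∃ x, GeneratesPow m T 1 x) :
    ∃ e F, 0 < e ∧ F ∈ m ^ e ∧ ∀ T ∈ s, GeneratesPow m T e F := by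
  classical
  induction s using Finset.strongInduction with
  | H s ih =>
    rcases s.eq_empty_or_nonempty with rfl | ⟨T₀, hT₀⟩
    -- For the empty family `F = 0` is allowed, so `F ≠ 0` has to come from the existence of a
    -- member.
    · exact ⟨1, 0, one_pos, zero_mem _, by simp⟩
    have hex (T) (hT : T ∈ s) : ∃ e F, 0 < e ∧ F ∈ m ^ e ∧
        ∀ T' ∈ s.erase T, GeneratesPow m T' e F :=
      ih _ (Finset.erase_ssubset hT) (fun T' h => hloc T' (Finset.mem_of_mem_erase h))
        fun T' h => hm T' (Finset.mem_of_mem_erase h)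
    by_cases hone : s = {T₀}
    · obtain ⟨x, hx⟩ := hm T₀ hT₀
      refine ⟨1, x, one_pos, hx.2.1, fun T hT => ?_⟩
      rw [hone, Finset.mem_singleton] at hT
      exact hT ▸ hx
    choose! e F he hF hgen using hex
    by_cases hgood : ∃ T ∈ s, GeneratesPow m T (e T) (F T)
    · obtain ⟨T, hT, h⟩ := hgood
      refine ⟨e T, F T, he T hT, hF T hT, fun T' hT' => ?_⟩
      by_cases hTT : T' = T
      · exact hTT ▸ h
      · exact hgen T hT T' (Finset.mem_erase.2 ⟨hTT, hT'⟩)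
    push Not at hgood
    have hne : (s.erase T₀).Nonempty := by
      rw [Finset.nonempty_iff_ne_empty]
      intro h0
      exact hone (by rw [← Finset.insert_erase hT₀, h0]; rfl)
    -- Each `F T` generates at every member of `s` except `T`. Hence `G` generates at `T₀` only, and
    -- `F T₀` everywhere except at `T₀`; the exponents `d` and `e T₀` bring both to degree `d * e
    -- T₀`, where their sum generates everywhere.
    set d := ∑ T ∈ s.erase T₀, e T with hd
    set G := ∏ T ∈ s.erase T₀, F T with hG
    have hd0 : 0 < d := Finset.sum_pos (fun T hT => he T (Finset.mem_of_mem_erase hT)) hne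
    have hFs : ∀ T ∈ s.erase T₀, F T ∈ m ^ e T := fun T hT => hF T (Finset.mem_of_mem_erase hT)
    have hGm : G ∈ m ^ d := mem_pow_sum_prod _ _ _ hFs
    have hG₀ : GeneratesPow m T₀ d G := prod _ _ _ fun T hT =>
      hgen T (Finset.mem_of_mem_erase hT) T₀
        (Finset.mem_erase.2 ⟨(Finset.ne_of_mem_erase hT).symm, hT₀⟩)
    have hGn : ∀ T ∈ s.erase T₀, ¬ GeneratesPow m T d G := by
      intro T hT h
      rw [hd, hG, ← Finset.add_sum_erase _ _ hT, ← Finset.mul_prod_erase _ _ hT] at h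
      exact hgood T (Finset.mem_of_mem_erase hT) (of_mul_left (hFs T hT)
        (mem_pow_sum_prod _ _ _ fun T' hT' => hFs T' (Finset.mem_of_mem_erase hT')) h)
    have hFd : F T₀ ^ d ∈ m ^ (d * e T₀) := by
      rw [mul_comm, pow_mul]; exact Ideal.pow_mem_pow (hF T₀ hT₀) d
    have hGd : G ^ e T₀ ∈ m ^ (d * e T₀) := by
      rw [pow_mul]; exact Ideal.pow_mem_pow hGm _
    refine ⟨d * e T₀, F T₀ ^ d + G ^ e T₀, Nat.mul_pos hd0 (he T₀ hT₀), add_mem hFd hGd,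
      fun T hT => ?_⟩
    have := hloc T hT
    by_cases hTT : T = T₀
    · subst hTT
      rw [add_comm]
      refine add_of_not (mul_comm d _ ▸ hG₀.pow _) hFd fun h => ?_
      exact hgood T hT (of_pow (hF T hT) hd0 h)
    · have hTe : T ∈ s.erase T₀ := Finset.mem_erase.2 ⟨hTT, hT⟩
      refine add_of_not ((hgen T₀ hT₀ T hTe).pow _) hGd fun h => ?_
      rw [mul_comm] at h
      exact hGn T hTe (of_pow hGm (he T₀ hT₀) h)

end GeneratesPow

end

end BirationalModel

/-! ### Centers of valuations on the blowup of the maximal ideal. -/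

namespace BirationalModel

open WithZero IsRegularLocalRing

section

variable {R K : Type*} [CommRing R] [IsDomain R] [IsRegularLocalRing R] [Field K] [Algebra R K]
  [IsFractionRing R K]

theorem algebraMap_ne_zero_of_notMem_sq {x : R} (hx' : x ∉ maximalIdeal R ^ 2) :
    algebraMap R K x ≠ 0 := by
  intro h
  rw [(IsFractionRing.injective R K).eq_iff' (map_zero _)] at h
  exact hx' (h ▸ zero_mem _)

theorem ordVal_lt_one_iff {z : K} : ordVal R K z < 1 ↔ ordVal R K z ≤ exp (-1 : ℤ) := by
  by_cases h0 : ordVal R K z = 0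
  · simp [h0]
  · rw [← exp_log h0, ← exp_zero, exp_lt_exp, exp_le_exp]
    omega

section Chart

variable {x : R} (hx : x ∈ maximalIdeal R) (hx' : x ∉ maximalIdeal R ^ 2)

include hx hx'

theorem ordVal_algebraMap_eq_exp_neg_one : ordVal R K (algebraMap R K x) = exp (-1 : ℤ) :=
  ordVal_algebraMap_eq (n := 1) (by simpa using hx) hx'

theorem ordVal_div_pow_le_iff {f : R} {k l : ℕ} :
    ordVal R K (algebraMap R K f / algebraMap R K x ^ k) ≤ exp (-(l : ℤ)) ↔
      f ∈ maximalIdeal R ^ (k + l) := by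
  rw [map_div₀, map_pow, ordVal_algebraMap_eq_exp_neg_one hx hx', ← exp_nsmul,
    div_le_iff₀ exp_pos, ← exp_add, ← ordVal_algebraMap_le_iff (K := K)]
  congr! 2
  push_cast
  rw [nsmul_eq_mul]
  ring

theorem ordVal_le_one_of_mem_blowupChart {z : K} (hz : z ∈ blowupChart K (maximalIdeal R) x) :
    ordVal R K z ≤ 1 := by
  obtain ⟨k, f, hf, rfl⟩ := (mem_blowupChart hx (algebraMap_ne_zero_of_notMem_sq hx')).1 hz
  exact (ordVal_div_pow_le_iff hx hx' (l := 0)).2 hf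

/-- If `f/xᵏ` has positive order then `f ∈ 𝔪ᵏ⁺¹`, and `f/xᵏ⁺¹` is again in the chart. Thus `x`
generates the center of `ord_R` on the chart. -/
theorem div_mem_blowupChart {z : K} (hz : z ∈ blowupChart K (maximalIdeal R) x)
    (h : ordVal R K z < 1) : z / algebraMap R K x ∈ blowupChart K (maximalIdeal R) x := by
  have hx0 := algebraMap_ne_zero_of_notMem_sq (K := K) hx'
  rw [mem_blowupChart hx hx0] at hz ⊢
  obtain ⟨k, f, hf, rfl⟩ := hz
  exact ⟨k + 1, f, (ordVal_div_pow_le_iff hx hx' (l := 1)).1 (ordVal_lt_one_iff.1 h), by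
    rw [div_div, pow_succ]⟩

/-- The charts of the blowup of the maximal ideal of a regular local ring are integrally closed. -/
theorem mem_blowupChart_of_isIntegral {z : K}
    (hz : IsIntegral (blowupChart K (maximalIdeal R) x) z) :
    z ∈ blowupChart K (maximalIdeal R) x := by
  have hx0 := algebraMap_ne_zero_of_notMem_sq (K := K) hx'
  -- The chart is the intersection of `R[1/x]` with the ring of `ord_R`: an integral `z` lies in the
  -- latter, and some `xᵏz` is integral over `R`, hence in `R`.
  have hv : ordVal R K z ≤ 1 :=
    valuation_le_one_of_isIntegral (fun _ => ordVal_le_one_of_mem_blowupChart hx hx') hz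
  have hRK : ∀ z : K, IsIntegral (⊥ : Subalgebra R K) z → z ∈ (⊥ : Subalgebra R K) := by
    intro z hz
    have := IsRegularLocalRing.isIntegrallyClosed (R := R)
    have hz' : IsIntegral R z := isIntegral_trans z hz
    exact Algebra.mem_bot.2 ((isIntegrallyClosed_iff K).1 this hz')
  obtain ⟨_, ⟨k, rfl⟩, h⟩ := exists_mul_mem_of_isIntegral
    (M := Submonoid.powers (algebraMap R K x)) hRK
    (by rintro _ ⟨k, rfl⟩; exact Subalgebra.pow_mem _ (Subalgebra.algebraMap_mem _ x) k) (by
      intro z hz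
      obtain ⟨k, f, hf, rfl⟩ := (mem_blowupChart hx hx0).1 hz
      refine ⟨_, ⟨k, rfl⟩, ?_⟩
      change algebraMap R K x ^ k * _ ∈ _
      rw [mul_div_cancel₀ _ (pow_ne_zero k hx0)]
      exact Subalgebra.algebraMap_mem _ f) hz
  obtain ⟨f, hf⟩ := Algebra.mem_bot.1 h
  have hzf : z = algebraMap R K f / algebraMap R K x ^ k := by
    rw [hf]; exact (mul_div_cancel_left₀ z (pow_ne_zero k hx0)).symm
  rw [mem_blowupChart hx hx0]
  rw [hzf] at hv
  exact ⟨k, f, (ordVal_div_pow_le_iff hx hx' (l := 0)).1 hv, hzf⟩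

end Chart

section Transform

variable {Γ : Type*} [LinearOrderedCommGroupWithZero Γ] {v : Valuation K Γ}

theorem valuation_algebraMap_le_pow {m : Ideal R} {x : R}
    (hR : ∀ r : R, v (algebraMap R K r) ≤ 1)
    (hm : ∀ y ∈ m, v (algebraMap R K y) ≤ v (algebraMap R K x)) {k : ℕ} {y : R} (hy : y ∈ m ^ k) :
    v (algebraMap R K y) ≤ v (algebraMap R K x) ^ k := by
  induction k generalizing y with
  | zero => simpa using hR y
  | succ k ih =>
    rw [pow_succ] at hy
    refine Submodule.mul_induction_on hy (fun a ha b hb => ?_) fun a b ha hb => ?_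
    · rw [map_mul, map_mul, pow_succ]
      exact mul_le_mul' (ih ha) (hm b hb)
    · rw [map_add]
      exact (v.map_add _ _).trans (max_le ha hb)

/-- The hypotheses on a valuation `v` of `K` and on `x` that make `R[𝔪/x]` localized at the center
of `v` the center of `v` on the blowup of the maximal ideal. -/
structure IsBlowupCenter (v : Valuation K Γ) (x : R) : Prop where
  mem : x ∈ maximalIdeal R
  notMem_sq : x ∉ maximalIdeal R ^ 2
  le_one : ∀ r : R, v (algebraMap R K r) ≤ 1
  le : ∀ y ∈ maximalIdeal R, v (algebraMap R K y) ≤ v (algebraMap R K x)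
  lt_one : v (algebraMap R K x) < 1

namespace IsBlowupCenter

variable {x : R} (h : IsBlowupCenter v x)

include h

theorem ne_zero : algebraMap R K x ≠ 0 := algebraMap_ne_zero_of_notMem_sq h.notMem_sq

theorem valuation_pos : 0 < v (algebraMap R K x) := by
  rw [zero_lt_iff, Valuation.ne_zero_iff]
  exact h.ne_zero

theorem le_pow {k : ℕ} {y : R} (hy : y ∈ maximalIdeal R ^ k) :
    v (algebraMap R K y) ≤ v (algebraMap R K x) ^ k :=
  valuation_algebraMap_le_pow h.le_one h.le hy

theorem valuation_le_one_of_mem_chart (z : K) (hz : z ∈ blowupChart K (maximalIdeal R) x) :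
    v z ≤ 1 := by
  obtain ⟨k, f, hf, rfl⟩ := (mem_blowupChart h.mem h.ne_zero).1 hz
  rw [map_div₀, map_pow]
  exact div_le_one_of_le₀ (h.le_pow hf) zero_le

/-- The local ring at the center of `v` on the blowup of the maximal ideal. -/
def transform : Subalgebra R K :=
  localizationAt _ (center v _ h.valuation_le_one_of_mem_chart)

theorem chart_le : blowupChart K (maximalIdeal R) x ≤ h.transform := le_localizationAt _ _

theorem isLocalRing_transform : IsLocalRing h.transform := isLocalRing_localizationAt

theorem valuation_le_one {z : K} (hz : z ∈ h.transform) : v z ≤ 1 :=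
  valuation_le_one_of_mem_localizationAt hz

theorem inv_mem {z : K} (hz : z ∈ h.transform) (h1 : v z = 1) : z⁻¹ ∈ h.transform :=
  inv_mem_localizationAt_center hz h1

theorem isUnit_iff {z : h.transform} : IsUnit z ↔ v (z : K) = 1 := by
  rw [isUnit_iff_inv_mem]
  constructor
  · rintro ⟨h0, h1⟩
    refine le_antisymm (h.valuation_le_one z.2) ?_
    have := h.valuation_le_one h1
    rwa [map_inv₀, inv_le_one₀ (zero_lt_iff.2 ((Valuation.ne_zero_iff v).2 h0))] at this
  · intro h1
    exact ⟨(Valuation.ne_zero_iff v).1 (h1 ▸ one_ne_zero), h.inv_mem z.2 h1⟩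

theorem mem_transform_of_isIntegral {z : K} (hz : IsIntegral h.transform z) : z ∈ h.transform :=
  mem_localizationAt_of_isIntegral
    (fun _ => mem_blowupChart_of_isIntegral h.mem h.notMem_sq) hz

/-- Were `c` of positive order, `c/x` would be in the chart with value `v(x)⁻¹ > 1`. So the
denominators allowed at the center of `v` have order 0, whence the local ring there lies in the ring
of `ord_R`. -/
theorem ordVal_eq_one {c : K} (hc : c ∈ blowupChart K (maximalIdeal R) x) (h1 : v c = 1) :
    ordVal R K c = 1 := by
  refine le_antisymm (ordVal_le_one_of_mem_blowupChart h.mem h.notMem_sq hc) ?_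
  by_contra hlt
  have h2 := h.valuation_le_one_of_mem_chart _
    (div_mem_blowupChart h.mem h.notMem_sq hc (not_le.1 hlt))
  rw [map_div₀, h1, one_div, inv_le_one₀ h.valuation_pos] at h2
  exact absurd h.lt_one (not_lt.2 h2)

theorem ordVal_le_one {z : K} (hz : z ∈ h.transform) : ordVal R K z ≤ 1 := by
  obtain ⟨b, hb, c, hc, hv, rfl⟩ := mem_localizationAt_center.1 hz
  rw [map_div₀, h.ordVal_eq_one hc hv, div_one]
  exact ordVal_le_one_of_mem_blowupChart h.mem h.notMem_sq hb

theorem div_mem {z : K} (hz : z ∈ h.transform) (h1 : ordVal R K z < 1) :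
    z / algebraMap R K x ∈ h.transform := by
  obtain ⟨b, hb, c, hc, hv, rfl⟩ := mem_localizationAt_center.1 hz
  rw [map_div₀, h.ordVal_eq_one hc hv, div_one] at h1
  refine mem_localizationAt_center.2
    ⟨_, div_mem_blowupChart h.mem h.notMem_sq hb h1, c, hc, hv, ?_⟩
  rw [div_div, div_div, mul_comm]

theorem div_pow_mem {z : K} (hz : z ∈ h.transform) {n : ℕ}
    (hn : ordVal R K z ≤ ordVal R K (algebraMap R K x) ^ n) :
    z / algebraMap R K x ^ n ∈ h.transform := by
  have hord := ordVal_algebraMap_eq_exp_neg_one (K := K) h.mem h.notMem_sq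
  have hpos : (0 : ℤᵐ⁰) < exp (-1 : ℤ) := exp_pos
  induction n with
  | zero => simpa using hz
  | succ n ih =>
    rw [hord] at hn ih
    have h1 : z / algebraMap R K x ^ n ∈ h.transform := ih (hn.trans (by
      rw [pow_succ]
      exact mul_le_of_le_one_right' (by rw [← exp_zero, exp_le_exp]; omega)))
    have h2 := h.div_mem h1 (by
      rw [ordVal_lt_one_iff, map_div₀, map_pow, hord, div_le_iff₀ (pow_pos hpos n), ← pow_succ']
      exact hn)
    rwa [div_div, ← pow_succ] at h2

theorem algebraMap_div_pow_mem {y : R} {k : ℕ} (hy : y ∈ maximalIdeal R ^ k) :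
    algebraMap R K y / algebraMap R K x ^ k ∈ h.transform :=
  h.chart_le ((mem_blowupChart h.mem h.ne_zero).2 ⟨k, y, hy, rfl⟩)

/-- Turns order into `v`-value: `g` has order `n`, so `g/xⁿ` lies in the transform and bounds `v g`
on one side; membership of `u` bounds it on the other. -/
theorem ordVal_mul_eq_one {g u : K} (hg : g ∈ h.transform) (hu : u ∈ h.transform) {n : ℕ}
    (hgu : algebraMap R K x ^ n = g * u) (h1 : ordVal R K u = 1) :
    v g = v (algebraMap R K x) ^ n := by
  have h2 : ordVal R K g = ordVal R K (algebraMap R K x) ^ n := by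
    rw [← map_pow, hgu, map_mul, h1, mul_one]
  have h3 := h.valuation_le_one (h.div_pow_mem hg h2.le)
  rw [map_div₀, map_pow, div_le_one₀ (pow_pos h.valuation_pos n)] at h3
  refine le_antisymm h3 ?_
  rw [← map_pow, hgu, map_mul]
  exact mul_le_of_le_one_right' (h.valuation_le_one hu)

end IsBlowupCenter

end Transform

end

end BirationalModel

/-! ### Centers that are base points. -/

theorem two_le_ringKrullDim_of_lt {T : Type*} [CommRing T] {p q r : Ideal T} [hp : p.IsPrime]
    [hq : q.IsPrime] [hr : r.IsPrime] (hpq : p < q) (hqr : q < r) : 2 ≤ ringKrullDim T := by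
  let l : LTSeries (PrimeSpectrum T) :=
    { length := 2
      toFun := ![⟨p, hp⟩, ⟨q, hq⟩, ⟨r, hr⟩]
      step := by
        intro i
        fin_cases i
        · exact hpq
        · exact hqr }
  exact Order.LTSeries.length_le_krullDim l

namespace BirationalModel

open WithZero IsRegularLocalRing

section

variable {R K : Type*} [CommRing R] [IsDomain R] [IsRegularLocalRing R] [Field K] [Algebra R K]
  [IsFractionRing R K] {Γ : Type*} [LinearOrderedCommGroupWithZero Γ] {v : Valuation K Γ}

namespace IsBlowupCenter

variable {x : R} (h : IsBlowupCenter v x)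

include h

theorem dominates_transform : Dominates h.transform := by
  refine ⟨fun r hr => ?_⟩
  by_contra hn
  have h1 : v (algebraMap R K r) = 1 := h.isUnit_iff.1 hr
  exact absurd ((h.le r ((mem_maximalIdeal r).2 hn)).trans_lt h.lt_one) (by rw [h1]; exact lt_irrefl 1)

/-- The center of `ord_R` lies strictly between the zero ideal and the maximal ideal: it contains
`x` and misses `t`. -/
theorem two_le_ringKrullDim_transform {t : K} (ht : t ∈ h.transform) (ht1 : v t < 1)
    (ht0 : ordVal R K t = 1) : 2 ≤ ringKrullDim h.transform := by
  have := h.isLocalRing_transform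
  refine two_le_ringKrullDim_of_lt (p := ⊥) (q := center (ordVal R K) h.transform
    fun _ => h.ordVal_le_one) (r := maximalIdeal h.transform) ?_ ?_
  · rw [bot_lt_iff_ne_bot, Submodule.ne_bot_iff]
    refine ⟨algebraMap R h.transform x, ?_, fun h0 => h.ne_zero (congrArg Subtype.val h0)⟩
    rw [mem_center, ordVal_lt_one_iff]
    exact (ordVal_algebraMap_eq_exp_neg_one h.mem h.notMem_sq).le
  · refine lt_of_le_of_ne (le_maximalIdeal Ideal.IsPrime.ne_top') fun heq => ?_
    have h1 : (⟨t, ht⟩ : h.transform) ∈ maximalIdeal h.transform := by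
      rw [mem_maximalIdeal, mem_nonunits_iff, h.isUnit_iff]
      exact ht1.ne
    rw [← heq, mem_center] at h1
    exact h1.ne ht0

/-- The extension of `I` to the center of `v` is contained in the principal ideal generated by a
power of `x`, and no smaller principal ideal. -/
theorem isLeast_span_pow {I : Ideal R} {r : ℕ} (hI : I ≤ maximalIdeal R ^ r) {b : R} (hb : b ∈ I)
    (hb' : b ∉ maximalIdeal R ^ (r + 1)) (hrad : x ∈ I.radical) :
    IsLeast {L : Ideal h.transform | Submodule.IsPrincipal L ∧
      I.map (algebraMap R h.transform) ≤ L} (Ideal.span {algebraMap R h.transform x ^ r}) := by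
  refine ⟨⟨⟨_, rfl⟩, ?_⟩, ?_⟩
  · rw [Ideal.map_le_iff_le_comap]
    intro y hy
    rw [Ideal.mem_comap, Ideal.mem_span_singleton']
    exact ⟨⟨_, h.algebraMap_div_pow_mem (hI hy)⟩,
      Subtype.ext (div_mul_cancel₀ _ (pow_ne_zero r h.ne_zero))⟩
  · rintro L ⟨⟨c, rfl⟩, hc⟩
    obtain ⟨N, hN⟩ := hrad
    have hord := ordVal_algebraMap_eq_exp_neg_one (K := K) h.mem h.notMem_sq
    have hmem (y : R) (hy : y ∈ I) : ∃ t : h.transform, (t : K) * c = algebraMap R K y := by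
      obtain ⟨t, ht⟩ := Ideal.mem_span_singleton'.1 (hc (Ideal.mem_map_of_mem _ hy))
      exact ⟨t, congrArg Subtype.val ht⟩
    -- Suppose `IT ⊆ cT`. Then `b` shows that `c` has order at most `r`, so in `xᴺxʳ = tc` the
    -- factor `t` has order at least `N`. Hence `xᴺ` divides `t` in `T`, and `c` divides `xʳ`.
    obtain ⟨s, hs⟩ := hmem b hb
    obtain ⟨t, ht⟩ := hmem (x ^ N * x ^ r) (I.mul_mem_right _ hN)
    have hbv : ordVal R K (algebraMap R K b) = ordVal R K (algebraMap R K x) ^ r := by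
      rw [ordVal_algebraMap_eq (hI hb) hb', hord, ← exp_nsmul, nsmul_eq_mul, mul_neg_one]
    have hcv : ordVal R K (algebraMap R K x) ^ r ≤ ordVal R K c := by
      rw [← hbv, ← hs, map_mul]
      exact mul_le_of_le_one_left' (h.ordVal_le_one s.2)
    have hcpos : 0 < ordVal R K c :=
      lt_of_lt_of_le (pow_pos (hord ▸ exp_pos) r) hcv
    have htv : ordVal R K t ≤ ordVal R K (algebraMap R K x) ^ N := by
      rw [← mul_le_mul_iff_left₀ hcpos, ← map_mul, ht, map_mul, map_mul, map_pow, map_pow, map_pow]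
      gcongr
      rwa [map_pow]
    change Ideal.span _ ≤ Ideal.span {c}
    rw [Ideal.span_singleton_le_iff_mem, Ideal.mem_span_singleton']
    refine ⟨⟨_, h.div_pow_mem t.2 htv⟩, Subtype.ext ?_⟩
    change (t : K) / algebraMap R K x ^ N * c = algebraMap R K x ^ r
    rw [div_mul_eq_mul_div, ht, map_mul, map_pow, map_pow,
      mul_div_cancel_left₀ _ (pow_ne_zero N h.ne_zero)]

/-- If `v` takes on `I` larger values than on `𝔪ʳ`, `r` the order of `I`, then the center of `v` on
the blowup of the maximal ideal is a base point of `I`. -/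
theorem transform_mem_basePoints {I : Ideal R} {r : ℕ} (hI : I ≤ maximalIdeal R ^ r) {b : R}
    (hb : b ∈ I) (hb' : b ∉ maximalIdeal R ^ (r + 1)) (hrad : x ∈ I.radical)
    (hlt : ∀ y ∈ I, v (algebraMap R K y) < v (algebraMap R K x) ^ r) :
    h.transform ∈ basePointsInFirstNeighborhood K I := by
  have hord := ordVal_algebraMap_eq_exp_neg_one (K := K) h.mem h.notMem_sq
  have hx0 : x ≠ 0 := fun h0 => h.ne_zero (by rw [h0, map_zero])
  have hv1 (y : R) (hy : y ∈ I) : v (algebraMap R K y / algebraMap R K x ^ r) < 1 := by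
    rw [map_div₀, map_pow, div_lt_one₀ (pow_pos h.valuation_pos r)]
    exact hlt y hy
  have := h.isLocalRing_transform
  -- The element `b/xʳ` has order 0 but lies in the maximal ideal, which gives dimension at least
  -- two.
  refine ⟨⟨⟨x, h.mem, hx0, _, inferInstance, rfl⟩, h.dominates_transform,
    h.two_le_ringKrullDim_transform (h.algebraMap_div_pow_mem (hI hb)) (hv1 b hb) ?_⟩,
    Ideal.span {t | ∃ y ∈ I, (t : K) = algebraMap R K y / algebraMap R K x ^ r},
    ⟨algebraMap R h.transform x ^ r, ?_, h.isLeast_span_pow hI hb hb' hrad, ?_⟩, ?_⟩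
  · rw [map_div₀, map_pow, ordVal_algebraMap_eq (hI hb) hb', hord, ← exp_nsmul, nsmul_eq_mul,
      mul_neg_one, div_self exp_ne_zero]
  · exact pow_ne_zero r fun h0 => h.ne_zero (congrArg Subtype.val h0)
  · rw [Ideal.span_mul_span', Ideal.map]
    congr 1
    ext z
    simp only [Set.singleton_mul, Set.mem_image, Set.mem_ofPred_eq, SetLike.mem_coe]
    constructor
    · rintro ⟨t, ⟨y, hy, ht⟩, rfl⟩
      refine ⟨y, hy, Subtype.ext ?_⟩
      change algebraMap R K y = algebraMap R K x ^ r * t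
      rw [ht, mul_div_cancel₀ _ (pow_ne_zero r h.ne_zero)]
    · rintro ⟨y, hy, rfl⟩
      refine ⟨⟨_, h.algebraMap_div_pow_mem (hI hy)⟩, ⟨y, hy, rfl⟩, Subtype.ext ?_⟩
      exact mul_div_cancel₀ _ (pow_ne_zero r h.ne_zero)
  · refine ne_top_of_le_ne_top (maximalIdeal.isMaximal h.transform).ne_top (Ideal.span_le.2 ?_)
    rintro t ⟨y, hy, ht⟩
    rw [SetLike.mem_coe, mem_maximalIdeal, mem_nonunits_iff, h.isUnit_iff, ht]
    exact (hv1 y hy).ne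

end IsBlowupCenter

end

end BirationalModel

/-! ### Divisorial hulls. -/

open scoped nonZeroDivisors

namespace FractionalIdeal

variable {A F : Type*} [CommRing A] [IsDomain A] [Field F] [Algebra A F] [IsFractionRing A F]

/-- Makes `pow_ne_zero` available for fractional ideals that need not be invertible. -/
instance : NoZeroDivisors (FractionalIdeal A⁰ F) where
  eq_zero_or_eq_zero_of_mul_eq_zero {I J} h := by
    by_contra! hne
    obtain ⟨hI, hJ⟩ := hne
    rw [Ne, FractionalIdeal.eq_zero_iff] at hI hJ
    push Not at hI hJ
    obtain ⟨x, hx, hx0⟩ := hI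
    obtain ⟨y, hy, hy0⟩ := hJ
    exact mul_ne_zero hx0 hy0
      (FractionalIdeal.eq_zero_iff.1 h _ (FractionalIdeal.mul_mem_mul hx hy))

theorem le_inv_iff_mul_le_one {X J : FractionalIdeal A⁰ F} (hJ : J ≠ 0) : X ≤ J⁻¹ ↔ X * J ≤ 1 := by
  rw [inv_eq, le_div_iff_mul_le hJ]

theorem le_inv_inv' {J : FractionalIdeal A⁰ F} (hJ : J ≠ 0) (hJ' : J⁻¹ ≠ 0) : J ≤ J⁻¹⁻¹ := by
  rw [le_inv_iff_mul_le_one hJ', mul_comm, ← le_inv_iff_mul_le_one hJ]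

theorem inv_inv_inv' {J : FractionalIdeal A⁰ F} (hJ : J ≠ 0) (hJ' : J⁻¹ ≠ 0) : J⁻¹⁻¹⁻¹ = J⁻¹ := by
  have h := le_inv_inv' hJ hJ'
  have h0 : J⁻¹⁻¹ ≠ 0 := ne_bot_of_le_ne_bot hJ h
  exact le_antisymm (inv_anti_mono hJ h0 h) (le_inv_inv' hJ' h0)

theorem inv_ne_zero_of_le_one {J : FractionalIdeal A⁰ F} (hJ : J ≠ 0) (h1 : J ≤ 1) : J⁻¹ ≠ 0 := by
  have : (1 : FractionalIdeal A⁰ F) ≤ J⁻¹ := by rwa [le_inv_iff_mul_le_one hJ, one_mul]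
  exact ne_bot_of_le_ne_bot one_ne_zero this

/-- Powers of a fractional ideal and of its divisorial hull have the same inverse. -/
theorem inv_inv_pow_inv {J : FractionalIdeal A⁰ F} (hJ : J ≠ 0) (hJ' : J⁻¹ ≠ 0) (n : ℕ) :
    (J⁻¹⁻¹ ^ n)⁻¹ = (J ^ n)⁻¹ := by
  have hle := le_inv_inv' hJ hJ'
  have h0 : J⁻¹⁻¹ ≠ 0 := ne_bot_of_le_ne_bot hJ hle
  refine le_antisymm (inv_anti_mono (pow_ne_zero n hJ) (pow_ne_zero n h0) (by gcongr)) ?_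
  rw [le_inv_iff_mul_le_one (pow_ne_zero n h0)]
  -- Replace one factor at a time: a product with `J` is at most 1 exactly when the cofactor is at
  -- most `J⁻¹ = J⁻¹⁻¹⁻¹`.
  have key : ∀ (n : ℕ) (X : FractionalIdeal A⁰ F), X * J ^ n ≤ 1 → X * J⁻¹⁻¹ ^ n ≤ 1 := by
    intro n
    induction n with
    | zero => simp
    | succ n ih =>
      intro X hX
      rw [pow_succ, ← mul_assoc, ← le_inv_iff_mul_le_one hJ, ← inv_inv_inv' hJ hJ',
        le_inv_iff_mul_le_one h0, mul_right_comm] at hX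
      rw [pow_succ', ← mul_assoc]
      exact ih _ hX
  exact key n _ ((le_inv_iff_mul_le_one (pow_ne_zero n hJ)).1 le_rfl)

end FractionalIdeal

namespace BirationalModel

section

variable {R K : Type*} [CommRing R] [Field K] [Algebra R K]

/-- The divisorial hull of the extension of `𝔪ⁿ` to `S` is generated by `g`. -/
structure IsHullGenerator (m : Ideal R) (S : Subalgebra R K) (n : ℕ) (g : K) : Prop where
  ne_zero : g ≠ 0
  div_mem : ∀ y ∈ m ^ n, algebraMap R K y / g ∈ S
  mem : ∀ z : K, (∀ y ∈ m ^ n, z * (algebraMap R K y / g) ∈ S) → z ∈ S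

namespace IsHullGenerator

variable {m : Ideal R} {S : Subalgebra R K} {n : ℕ} {g : K}

theorem self_mem (h : IsHullGenerator m S n g) : g ∈ S :=
  h.mem g fun y _ => by rw [mul_div_cancel₀ _ h.ne_zero]; exact S.algebraMap_mem y

theorem div_pow_mem (h : IsHullGenerator m S n g) {r : ℕ} {y : R} (hy : y ∈ m ^ (n * r)) :
    algebraMap R K y / g ^ r ∈ S := by
  induction r generalizing y with
  | zero => simp
  | succ r ih =>
    rw [Nat.mul_succ, pow_add] at hy
    refine Submodule.mul_induction_on hy (fun a ha b hb => ?_) fun a b ha hb => ?_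
    · rw [map_mul, pow_succ, ← div_mul_div_comm]
      exact S.mul_mem (ih ha) (h.div_mem b hb)
    · rw [map_add, add_div]; exact S.add_mem ha hb

end IsHullGenerator

/-- `g` is the gcd of a finite generating set of `𝔪`; the hull property is the rule `gcd(p·y) =
p·gcd(y)` up to a unit. -/
theorem exists_isHullGenerator_of_uniqueFactorizationMonoid [IsFractionRing R K] [IsDomain R]
    {m : Ideal R} (hfg : m.FG) (hm : m ≠ ⊥) (S : Subalgebra R K)
    [UniqueFactorizationMonoid S] : ∃ g, IsHullGenerator m S 1 g := by
  classical
  obtain ⟨s, hs⟩ := hfg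
  let _ : NormalizedGCDMonoid S := Classical.choice inferInstance
  set G : S := s.gcd (algebraMap R S) with hG
  have hinj : Function.Injective (algebraMap R S) := fun a b hab =>
    IsFractionRing.injective R K (congrArg Subtype.val hab)
  have hG0 : G ≠ 0 := by
    intro h0
    rw [hG, Finset.gcd_eq_zero_iff] at h0
    refine hm (le_bot_iff.1 (hs ▸ Ideal.span_le.2 fun y hy => ?_))
    exact hinj ((h0 y hy).trans (map_zero _).symm)
  have hG0' : (G : K) ≠ 0 := fun h => hG0 (Subtype.ext h)
  have hdvd : ∀ y ∈ m, G ∣ algebraMap R S y := by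
    intro y hy
    have : m ≤ (Ideal.span {G}).comap (algebraMap R S) := by
      rw [← hs]
      refine Ideal.span_le.2 fun y hy => ?_
      rw [SetLike.mem_coe, Ideal.mem_comap, Ideal.mem_span_singleton]
      exact Finset.gcd_dvd hy
    exact Ideal.mem_span_singleton.1 (this hy)
  refine ⟨G, hG0', fun y hy => ?_, fun z hz => ?_⟩
  · rw [pow_one] at hy
    obtain ⟨t, ht⟩ := hdvd y hy
    have ht' : algebraMap R K y = G * t := congrArg Subtype.val ht
    rw [ht', mul_div_cancel_left₀ _ hG0']
    exact t.2
  · obtain ⟨p, q, hq, rfl⟩ := IsFractionRing.div_surjective (A := S) z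
    have hq0 : (q : K) ≠ 0 := fun h => nonZeroDivisors.ne_zero hq (Subtype.ext h)
    have h1 : G * q ∣ s.gcd fun y => p * algebraMap R S y := by
      refine Finset.dvd_gcd fun y hy => ?_
      have hy' : y ∈ m := hs ▸ Ideal.subset_span hy
      refine ⟨⟨_, hz y (by rwa [pow_one])⟩, Subtype.ext ?_⟩
      change (p : K) * algebraMap R K y = G * q * ((p : K) / q * (algebraMap R K y / G))
      field_simp
    have h2 := h1.trans (Finset.gcd_mul_left' s (algebraMap R S) p).dvd
    rw [← hG, mul_comm G, mul_dvd_mul_iff_right hG0] at h2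
    obtain ⟨t, ht⟩ := h2
    have ht' : (p : K) = q * t := congrArg Subtype.val ht
    change (p : K) / q ∈ S
    rw [ht', mul_div_cancel_left₀ _ hq0]
    exact t.2

/-- Apply torsion to the hull of `M`. Powers of `M` and of its hull have the same inverse, so
`(Mⁿ)⁻¹ = x⁻¹A`. The elementwise form is the one that transports along the isomorphism from
`FractionRing A` to another fraction field. -/
theorem HasTorsionDivisorClassGroup.exists_pow_hull_eq {A : Type*} [CommRing A] [IsDomain A]
    (h : HasTorsionDivisorClassGroup A) {M : Ideal A} (hM0 : M ≠ ⊥) :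
    ∃ n, 0 < n ∧ ∃ x : FractionRing A, x ≠ 0 ∧
      (∀ w ∈ M ^ n, ∃ s : A, algebraMap A (FractionRing A) w = algebraMap A _ s * x) ∧
      ∀ z : FractionRing A, (∀ w ∈ M ^ n, ∃ s : A, z * algebraMap A _ w = algebraMap A _ s * x) →
        ∃ s : A, z = algebraMap A _ s := by
  set J : FractionalIdeal A⁰ (FractionRing A) := (M : FractionalIdeal A⁰ (FractionRing A)) with hJ
  have hJ0 : J ≠ 0 := FractionalIdeal.coeIdeal_ne_zero.2 hM0
  have hJi : J⁻¹ ≠ 0 :=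
    FractionalIdeal.inv_ne_zero_of_le_one hJ0 FractionalIdeal.coeIdeal_le_one
  have hJii : J⁻¹⁻¹ ≠ 0 := ne_bot_of_le_ne_bot hJ0 (FractionalIdeal.le_inv_inv' hJ0 hJi)
  obtain ⟨n, hn, x, hx0, hx⟩ := h J⁻¹⁻¹ hJii (by rw [FractionalIdeal.inv_inv_inv' hJ0 hJi])
  rw [FractionalIdeal.inv_inv_pow_inv hJ0 hJi] at hx
  have hJn : J ^ n = (M ^ n : Ideal A) := by rw [hJ, ← FractionalIdeal.coeIdeal_pow]
  rw [hJn] at hx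
  have hA0 : ((M ^ n : Ideal A) : FractionalIdeal A⁰ (FractionRing A)) ≠ 0 :=
    hJn ▸ pow_ne_zero n hJ0
  clear_value J
  set B := ((M ^ n : Ideal A) : FractionalIdeal A⁰ (FractionRing A)) with hB
  have hAi : B⁻¹ ≠ 0 :=
    FractionalIdeal.inv_ne_zero_of_le_one hA0 FractionalIdeal.coeIdeal_le_one
  have hAx : B⁻¹ = FractionalIdeal.spanSingleton A⁰ x⁻¹ := by
    rw [← FractionalIdeal.inv_inv_inv' hA0 hAi, hx, FractionalIdeal.spanSingleton_inv]
  refine ⟨n, hn, x, hx0, fun w hw => ?_, fun z hz => ?_⟩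
  · have h2 := FractionalIdeal.le_inv_inv' hA0 hAi (FractionalIdeal.mem_coeIdeal_of_mem _ hw)
    rw [hx, FractionalIdeal.mem_spanSingleton] at h2
    obtain ⟨s, hs⟩ := h2
    exact ⟨s, by rw [← hs, Algebra.smul_def]⟩
  · have h1 : z / x ∈ B⁻¹ := by
      rw [FractionalIdeal.mem_inv_iff hA0]
      intro y hy
      obtain ⟨w, hw, rfl⟩ := (FractionalIdeal.mem_coeIdeal _).1 hy
      obtain ⟨s, hs⟩ := hz w hw
      rw [div_mul_eq_mul_div, hs, mul_div_cancel_right₀ _ hx0]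
      exact FractionalIdeal.coe_mem_one _ s
    rw [hAx, FractionalIdeal.mem_spanSingleton] at h1
    obtain ⟨s, hs⟩ := h1
    refine ⟨s, ?_⟩
    rw [Algebra.smul_def, div_eq_mul_inv] at hs
    exact (mul_right_cancel₀ (inv_ne_zero hx0) hs).symm

theorem exists_isHullGenerator_of_torsion [IsFractionRing R K] [IsDomain R]
    {m : Ideal R} (hm : m ≠ ⊥) (S : Subalgebra R K) (h : HasTorsionDivisorClassGroup S) :
    ∃ n, 0 < n ∧ ∃ g, IsHullGenerator m S n g := by
  have hinj : Function.Injective (algebraMap R S) := fun a b hab =>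
    IsFractionRing.injective R K (congrArg Subtype.val hab)
  have hM0 : m.map (algebraMap R S) ≠ ⊥ := by
    rw [Ne, Ideal.map_eq_bot_iff_of_injective hinj]
    exact hm
  obtain ⟨n, hn, x, hx0, h1, h2⟩ := h.exists_pow_hull_eq hM0
  let e : FractionRing S ≃ₐ[S] K := FractionRing.algEquiv S K
  have hex : e x ≠ 0 := by rwa [Ne, map_eq_zero_iff e e.injective]
  have he (s : S) : e (algebraMap S _ s) = s := e.commutes s
  rw [← Ideal.map_pow] at h1 h2
  refine ⟨n, hn, e x, hex, fun y hy => ?_, fun z hz => ?_⟩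
  · obtain ⟨s, hs⟩ := h1 _ (Ideal.mem_map_of_mem _ hy)
    have hs' := congrArg e hs
    rw [he, map_mul, he] at hs'
    change algebraMap R K y = s * e x at hs'
    rw [hs', mul_div_cancel_right₀ _ hex]
    exact s.2
  · have h3 : ∀ w ∈ (m ^ n).map (algebraMap R S), z * (w : K) / e x ∈ S := by
      intro w hw
      refine Submodule.span_induction (p := fun (w : S) _ => z * (w : K) / e x ∈ S) ?_ ?_ ?_ ?_ hw
      · rintro _ ⟨y, hy, rfl⟩
        rw [mul_div_assoc]
        exact hz y hy
      · simp
      · intro a b _ _ ha hb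
        rw [AddMemClass.coe_add, mul_add, add_div]
        exact S.add_mem ha hb
      · intro a b _ hb
        rw [smul_eq_mul, MulMemClass.coe_mul, mul_left_comm, mul_div_assoc]
        exact S.mul_mem a.2 hb
    obtain ⟨s, hs⟩ := h2 (e.symm z) fun w hw => ⟨⟨_, h3 w hw⟩, e.injective (by
      rw [map_mul, e.apply_symm_apply, he, map_mul, he]
      exact (div_mul_cancel₀ _ hex).symm)⟩
    rw [e.symm_apply_eq, he] at hs
    exact hs ▸ s.2

end

end BirationalModel

/-! ### Valuations dominating `S` and the two cases of the proof. -/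

namespace BirationalModel

open WithZero IsRegularLocalRing

section

variable {R K : Type*} [CommRing R] [Field K] [Algebra R K]

/-- The valuation ring of `v` dominates `S`. -/
structure DominatesRing {Γ : Type*} [LinearOrderedCommGroupWithZero Γ] (v : Valuation K Γ)
    (S : Subalgebra R K) : Prop where
  le_one : ∀ z ∈ S, v z ≤ 1
  inv_mem : ∀ z ∈ S, v z = 1 → z⁻¹ ∈ S

/-- An integrally closed local ring is the intersection of the valuation rings dominating it; this
is the test used for membership in `S`. -/
theorem exists_valuationSubring_dominatesRing {S : Subalgebra R K} [IsLocalRing S]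
    (hS : ∀ z : K, IsIntegral S z → z ∈ S) {u : K} (hu : u ∉ S) :
    ∃ W : ValuationSubring K, DominatesRing W.valuation S ∧ u ∉ W := by
  let A : LocalSubring K := { toSubring := S.toSubring, isLocalRing := ‹IsLocalRing S› }
  have : IsIntegrallyClosedIn A.toSubring K := Subring.isIntegrallyClosedIn_iff.2 fun z hz => hS z hz
  obtain ⟨W, ⟨hle, hloc⟩, huW⟩ :=
    LocalSubring.exists_le_valuationSubring_of_isIntegrallyClosedIn (R := A) hu
  refine ⟨W, ⟨fun z hz => (W.valuation_le_one_iff z).2 (hle hz), fun z hz h1 => ?_⟩, huW⟩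
  have h0 : z ≠ 0 := (Valuation.ne_zero_iff W.valuation).1 (h1 ▸ one_ne_zero)
  have hzi : z⁻¹ ∈ W := (W.valuation_le_one_iff _).1 (by rw [map_inv₀, h1, inv_one])
  have hunit : IsUnit (Subring.inclusion hle ⟨z, hz⟩) :=
    IsUnit.of_mul_eq_one (⟨z⁻¹, hzi⟩ : W.toSubring) (Subtype.ext (mul_inv_cancel₀ h0))
  have h2 : IsUnit (⟨z, hz⟩ : S) := hloc.map_nonunit _ hunit
  exact (isUnit_iff_inv_mem.1 h2).2

theorem mem_of_isIntegral_of_mem_normalizedBlowup {I : Ideal R} {S : Subalgebra R K}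
    (hS : S ∈ normalizedBlowup K I) {z : K} (hz : IsIntegral S z) : z ∈ S := by
  obtain ⟨a, -, -, P, hP, rfl⟩ := hS
  exact mem_localizationAt_of_isIntegral (fun _ => mem_normalizedBlowupChart_of_isIntegral) hz

theorem isLocalRing_of_mem_normalizedBlowup {I : Ideal R} {S : Subalgebra R K}
    (hS : S ∈ normalizedBlowup K I) : IsLocalRing S := by
  obtain ⟨a, -, -, P, hP, rfl⟩ := hS
  exact isLocalRing_localizationAt

theorem div_mem_of_mem_normalizedBlowupChart_le {I : Ideal R} {a : R} {S : Subalgebra R K}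
    (h : normalizedBlowupChart K I a ≤ S) {b : R} (hb : b ∈ I) :
    algebraMap R K b / algebraMap R K a ∈ S :=
  blowupChart_le_iff.1 ((blowupChart_le_normalizedBlowupChart I a).trans h) b hb

theorem isLocalRing_and_exists_generatesPow [IsLocalRing R] [FaithfulSMul R K]
    {T : Subalgebra R K}
    (hT : T ∈ firstNeighborhood R K) :
    IsLocalRing T ∧ ∃ x, GeneratesPow (maximalIdeal R) T 1 x := by
  obtain ⟨⟨x, hx, hx0, P, hP, rfl⟩, -, -⟩ := hT
  refine ⟨isLocalRing_localizationAt, x, ?_, by simpa using hx, fun y hy => ?_⟩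
  · rwa [Ne, (FaithfulSMul.algebraMap_injective R K).eq_iff' (map_zero _)]
  · exact blowupChart_le_iff.1 (le_localizationAt _ P) y (by simpa using hy)

end

section

variable {R K : Type*} [CommRing R] [IsDomain R] [IsRegularLocalRing R] [Field K] [Algebra R K]
  [IsFractionRing R K] {Γ : Type*} [LinearOrderedCommGroupWithZero Γ] {v : Valuation K Γ}

theorem algebraMap_lt_one_of_dominates {S : Subalgebra R K} (hdom : Dominates S)
    (hv : DominatesRing v S) {y : R} (hy : y ∈ maximalIdeal R) : v (algebraMap R K y) < 1 := by
  refine lt_of_le_of_ne (hv.le_one _ (S.algebraMap_mem y)) fun h1 => (mem_maximalIdeal y).1 hy ?_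
  refine hdom.map_nonunit _ (isUnit_iff_inv_mem.2 ⟨?_, hv.inv_mem _ (S.algebraMap_mem y) h1⟩)
  exact (Valuation.ne_zero_iff v).1 (h1 ▸ one_ne_zero)

/-- Take `x` of largest multiplicative value among finitely many generators of `𝔪`. If `x` were in
`𝔪²`, then `v(x) ≤ v(x)² < v(x)`. -/
theorem exists_isBlowupCenter (hm : maximalIdeal R ≠ ⊥) {S : Subalgebra R K} (hdom : Dominates S)
    (hv : DominatesRing v S) : ∃ x : R, IsBlowupCenter v x := by
  obtain ⟨s, hs⟩ : (maximalIdeal R).FG := IsNoetherian.noetherian _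
  have hR (r : R) : v (algebraMap R K r) ≤ 1 := hv.le_one _ (S.algebraMap_mem r)
  have hne : s.Nonempty := by
    rw [Finset.nonempty_iff_ne_empty]
    rintro rfl
    exact hm (by rw [← hs]; simp)
  obtain ⟨x, hxs, hmax⟩ := s.exists_max_image (fun y => v (algebraMap R K y)) hne
  have hx : x ∈ maximalIdeal R := hs ▸ Ideal.subset_span hxs
  have hle : ∀ y ∈ maximalIdeal R, v (algebraMap R K y) ≤ v (algebraMap R K x) := by
    intro y hy
    rw [← hs] at hy
    induction hy using Submodule.span_induction with
    | mem y hy => exact hmax y hy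
    | zero => simp
    | add a b _ _ ha hb => rw [map_add]; exact (v.map_add _ _).trans (max_le ha hb)
    | smul a b _ hb =>
      rw [smul_eq_mul, map_mul, map_mul]
      exact (mul_le_of_le_one_left' (hR a)).trans hb
  have hlt := algebraMap_lt_one_of_dominates hdom hv hx
  refine ⟨x, hx, fun hx2 => ?_, hR, hle, hlt⟩
  have hpos : 0 < v (algebraMap R K x) := by
    obtain ⟨y, hy, hy0⟩ := Submodule.exists_mem_ne_zero_of_ne_bot hm
    refine lt_of_lt_of_le (zero_lt_iff.2 ?_) (hle y hy)
    rw [Valuation.ne_zero_iff, Ne, (IsFractionRing.injective R K).eq_iff' (map_zero _)]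
    exact hy0
  have h2 := valuation_algebraMap_le_pow hR hle hx2
  rw [pow_two] at h2
  exact absurd h2 (not_le.2 (mul_lt_of_lt_one_left hpos hlt))

theorem exists_order {I : Ideal R} (hI : I ≠ ⊥) :
    ∃ r, I ≤ maximalIdeal R ^ r ∧ ∃ b ∈ I, b ∉ maximalIdeal R ^ (r + 1) := by
  classical
  have hex : ∃ n, ∃ b ∈ I, b ∉ maximalIdeal R ^ (n + 1) := by
    obtain ⟨b, hb, hb0⟩ := Submodule.exists_mem_ne_zero_of_ne_bot hI
    obtain ⟨n, -, hn⟩ := exists_notMem_pow_succ hb0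
    exact ⟨n, b, hb, hn⟩
  refine ⟨Nat.find hex, fun b hb => ?_, Nat.find_spec hex⟩
  rcases h : Nat.find hex with _ | k
  · simp
  · have := Nat.find_min hex (m := k) (by omega)
    push Not at this
    exact this b hb

/-- If every valuation ring dominating `S` takes on `I` larger values than on `𝔪ʳ`, `r` the order of
`I`, and `I` has only finitely many base points, then `𝔪S` is principal. -/
theorem isPrincipal_of_forall_valuation_lt (hm : maximalIdeal R ≠ ⊥) {I : Ideal R}
    (hrad : I.radical = maximalIdeal R) (hfin : (basePointsInFirstNeighborhood K I).Finite)
    {S : Subalgebra R K} [IsLocalRing S] (hS : ∀ z : K, IsIntegral S z → z ∈ S)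
    (hdom : Dominates S) {r : ℕ} (hI : I ≤ maximalIdeal R ^ r) {b : R} (hb : b ∈ I)
    (hb' : b ∉ maximalIdeal R ^ (r + 1))
    (hlt : ∀ W : ValuationSubring K, DominatesRing W.valuation S → ∀ x,
      IsBlowupCenter W.valuation x → ∀ y ∈ I,
        W.valuation (algebraMap R K y) < W.valuation (algebraMap R K x) ^ r) :
    Submodule.IsPrincipal ((maximalIdeal R).map (algebraMap R S)) := by
  obtain ⟨e, F, he, hF, hgen⟩ := GeneratesPow.exists_forall (m := maximalIdeal R) hfin.toFinset
    (fun T hT => (isLocalRing_and_exists_generatesPow (hfin.mem_toFinset.1 hT).1).1)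
    (fun T hT => (isLocalRing_and_exists_generatesPow (hfin.mem_toFinset.1 hT).1).2)
  -- A dominating valuation ring `W` omits `u`, and its center on the blowup of `𝔪` is a base point,
  -- where `F` generates.
  have key : ∀ u ∉ S, ∃ (W : ValuationSubring K) (T : Subalgebra R K), u ∉ W ∧
      (∀ z ∈ T, z ∈ W) ∧ GeneratesPow (maximalIdeal R) T e F := by
    intro u hu
    obtain ⟨W, hW, huW⟩ := exists_valuationSubring_dominatesRing hS hu
    obtain ⟨x, hx⟩ := exists_isBlowupCenter hm hdom hW
    refine ⟨W, hx.transform, huW, fun z hz => (W.valuation_le_one_iff z).1 (hx.valuation_le_one hz),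
      hgen _ (hfin.mem_toFinset.2 (hx.transform_mem_basePoints hI hb hb' (hrad ▸ hx.mem)
        (hlt W hW x hx)))⟩
  refine GeneratesPow.isPrincipal_map he (F := F) ⟨?_, hF, fun y hy => ?_⟩
  · obtain ⟨y, hy, hy0⟩ := Submodule.exists_mem_ne_zero_of_ne_bot hm
    have hyK : algebraMap R K y ≠ 0 := by
      rwa [Ne, (IsFractionRing.injective R K).eq_iff' (map_zero _)]
    -- Since `y⁻¹ ∉ S`, there is at least one base point, and this gives `F ≠ 0`.
    have hyS : (algebraMap R K y)⁻¹ ∉ S := fun h =>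
      (mem_maximalIdeal y).1 hy (hdom.map_nonunit y (isUnit_iff_inv_mem.2 ⟨hyK, h⟩))
    obtain ⟨-, T, -, -, hT⟩ := key _ hyS
    exact hT.1
  · by_contra hyS
    obtain ⟨W, T, huW, hTW, hT⟩ := key _ hyS
    exact huW (hTW _ (hT.2.2 y hy))

/-- In the transform `T`, `a/xʳ` is a unit, so every `b/a` with `b ∈ I` lies in `T`; as `T` is
integrally closed it contains the normalized chart. Denominators outside `P` are units of `S`, hence
of value 1, and so are units of `T`. -/
theorem le_transform {I : Ideal R} {a x : R} {r : ℕ} (h : IsBlowupCenter v x)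
    (hI : I ≤ maximalIdeal R ^ r) (ha : a ∈ I)
    (hva : v (algebraMap R K a) = v (algebraMap R K x) ^ r)
    {P : Ideal (normalizedBlowupChart K I a)} [P.IsPrime]
    (hv : DominatesRing v (localizationAt (normalizedBlowupChart K I a) P)) :
    localizationAt (normalizedBlowupChart K I a) P ≤ h.transform := by
  have hxr : v (algebraMap R K x) ^ r ≠ 0 := (pow_pos h.valuation_pos r).ne'
  have hinv : (algebraMap R K a / algebraMap R K x ^ r)⁻¹ ∈ h.transform :=
    h.inv_mem (h.algebraMap_div_pow_mem (hI ha)) (by rw [map_div₀, map_pow, hva, div_self hxr])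
  have hB : normalizedBlowupChart K I a ≤ h.transform := by
    refine normalizedBlowupChart_le (fun _ => h.mem_transform_of_isIntegral) fun b hb => ?_
    have := mul_mem (h.algebraMap_div_pow_mem (hI hb)) hinv
    rwa [inv_div, div_mul_div_cancel₀ (pow_ne_zero r h.ne_zero)] at this
  rintro _ ⟨b, c, hc, rfl⟩
  have hc1 : v (c : K) = 1 := by
    refine le_antisymm (hv.le_one _ (le_localizationAt _ P c.2)) ?_
    have := hv.le_one _ (inv_mem_localizationAt hc)
    rwa [map_inv₀, inv_le_one₀] at this
    rw [zero_lt_iff, Valuation.ne_zero_iff]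
    exact coe_ne_zero_of_notMem hc
  rw [div_eq_mul_inv]
  exact mul_mem (hB b.2) (h.inv_mem (hB c.2) hc1)

/-- If the divisorial hull of `𝔪ⁿS` is generated by an element whose value is that of `𝔪ⁿ`, for a
valuation that takes the same value on `IS = aS` and `𝔪ʳ`, then `𝔪S` is principal. -/
theorem IsHullGenerator.isPrincipal_map {S : Subalgebra R K} [IsLocalRing S]
    (hv : DominatesRing v S) {a x : R} {r n : ℕ} (h : IsBlowupCenter v x) (hn : 0 < n) (hr : 0 < r)
    (ha : a ∈ maximalIdeal R ^ r) (hva : v (algebraMap R K a) = v (algebraMap R K x) ^ r) {g : K}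
    (hg : IsHullGenerator (maximalIdeal R) S n g) (hvg : v g = v (algebraMap R K x) ^ n) :
    Submodule.IsPrincipal ((maximalIdeal R).map (algebraMap R S)) := by
  have hx0 : v (algebraMap R K x) ≠ 0 := h.valuation_pos.ne'
  have ha0 : algebraMap R K a ≠ 0 :=
    (Valuation.ne_zero_iff v).1 (hva ▸ pow_ne_zero r hx0)
  have han : a ^ n ∈ maximalIdeal R ^ (n * r) := by
    rw [mul_comm, pow_mul]; exact Ideal.pow_mem_pow ha n
  have hw := hg.div_pow_mem han
  have hwi := hv.inv_mem _ hw (by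
    rw [map_div₀, map_pow, map_pow, map_pow, hva, hvg, ← pow_mul, ← pow_mul, mul_comm,
      div_self (pow_ne_zero _ hx0)])
  refine GeneratesPow.isPrincipal_map (Nat.mul_pos hn hr) (F := a ^ n)
    ⟨by rw [map_pow]; exact pow_ne_zero n ha0, han, fun y hy => ?_⟩
  have := mul_mem (hg.div_pow_mem hy) hwi
  rwa [inv_div, div_mul_div_cancel₀ (pow_ne_zero r hg.ne_zero)] at this

/-- In a factorial point of the normalized blowup, the greatest common divisor of `𝔪S` is a
nonunit. -/
theorem IsHullGenerator.valuation_lt_one_of_uniqueFactorizationMonoid {I : Ideal R}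
    (hrad : I.radical = maximalIdeal R) {a : R} (ha : a ∈ I) (ha0 : a ≠ 0) {S : Subalgebra R K}
    [UniqueFactorizationMonoid S] (hB : normalizedBlowupChart K I a ≤ S) (hdom : Dominates S)
    (hv : DominatesRing v S) {g : K} (hg : IsHullGenerator (maximalIdeal R) S 1 g) : v g < 1 := by
  have hinj : Function.Injective (algebraMap R S) := fun a b hab =>
    IsFractionRing.injective R K (congrArg Subtype.val hab)
  have haK : algebraMap R K a ≠ 0 := by
    rwa [Ne, (IsFractionRing.injective R K).eq_iff' (map_zero _)]
  have hau : ¬ IsUnit (algebraMap R S a) := fun h =>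
    (mem_maximalIdeal a).1 (hrad ▸ Ideal.le_radical ha) (hdom.map_nonunit a h)
  obtain ⟨p, hp, hpa⟩ := WfDvdMonoid.exists_irreducible_factor hau
    (by rwa [Ne, hinj.eq_iff' (map_zero _)])
  have hp' : Prime p := UniqueFactorizationMonoid.irreducible_iff_prime.1 hp
  have hp0 : (p : K) ≠ 0 := fun h => hp'.ne_zero (Subtype.ext h)
  -- A power of `y` lies in `I`, hence in `aS ⊆ pS`, so `p` divides `y`. The hull property then
  -- makes `p` divide `g`.
  have hpm : ∀ y ∈ maximalIdeal R, algebraMap R K y / p ∈ S := by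
    intro y hy
    obtain ⟨N, hN⟩ : y ∈ I.radical := hrad ▸ hy
    have h1 : algebraMap R S a ∣ algebraMap R S y ^ N := by
      refine ⟨⟨_, div_mem_of_mem_normalizedBlowupChart_le hB hN⟩, Subtype.ext ?_⟩
      change algebraMap R K y ^ N = _ * (algebraMap R K (y ^ N) / _)
      rw [map_pow]
      exact (mul_div_cancel₀ _ haK).symm
    obtain ⟨t, ht⟩ := hp'.dvd_of_dvd_pow (hpa.trans h1)
    have ht' : algebraMap R K y = p * t := congrArg Subtype.val ht
    rw [ht', mul_div_cancel_left₀ _ hp0]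
    exact t.2
  have hgp : g / p ∈ S := hg.mem _ fun y hy => by
    rw [mul_comm, div_mul_div_cancel₀ hg.ne_zero]
    exact hpm y (by rwa [pow_one] at hy)
  have hvp : v p < 1 := by
    refine lt_of_le_of_ne (hv.le_one _ p.2) fun h1 => hp.not_isUnit ?_
    exact isUnit_iff_inv_mem.2 ⟨hp0, hv.inv_mem _ p.2 h1⟩
  have := mul_lt_one_of_nonneg_of_lt_one_right (hv.le_one _ hgp) zero_le hvp
  rwa [← map_mul, div_mul_cancel₀ _ hp0] at this

/-- A nonunit generator of the divisorial hull of `𝔪S` has the value of `𝔪`. -/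
theorem IsHullGenerator.valuation_eq_of_lt_one {S : Subalgebra R K} {x : R}
    (h : IsBlowupCenter v x) (hS : S ≤ h.transform) {g : K}
    (hg : IsHullGenerator (maximalIdeal R) S 1 g) (hvg : v g < 1) :
    v g = v (algebraMap R K x) := by
  have hu := hS (hg.div_mem x (by rw [pow_one]; exact h.mem))
  have hgu : algebraMap R K x ^ 1 = g * (algebraMap R K x / g) := by
    rw [pow_one, mul_div_cancel₀ _ hg.ne_zero]
  -- If `u = x/g` had positive order, `x` would divide it in the transform, so `1/g` would lie
  -- there, contradicting `v g < 1`.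
  rcases (h.ordVal_le_one hu).lt_or_eq with hlt | heq
  · exfalso
    have h1 := mul_lt_one_of_nonneg_of_lt_one_right (h.valuation_le_one (h.div_mem hu hlt)) zero_le hvg
    rw [← map_mul, div_right_comm, div_self h.ne_zero, one_div, inv_mul_cancel₀ hg.ne_zero,
      map_one] at h1
    exact lt_irrefl _ h1
  · rw [h.ordVal_mul_eq_one (hS hg.self_mem) hu hgu heq, pow_one]

/-- If the order valuation ring is a Rees valuation ring of `I` containing the point `S` of the
normalized blowup, it is a localization of `S`. -/
theorem exists_mul_mem_of_ordVal_le_one {I : Ideal R} {a : R} (ha : a ∈ I) (ha0 : a ≠ 0)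
    {S : Subalgebra R K} (hS : ∀ z : K, IsIntegral S z → z ∈ S)
    (hB : normalizedBlowupChart K I a ≤ S) (hSV : ∀ z ∈ S, ordVal R K z ≤ 1)
    {V : Subalgebra R K} (hV : V ∈ normalizedBlowup K I)
    (hVord : (V : Set K) = ordValuationRing R K) {M : Submonoid K}
    (hM : ∀ c, c ∈ M ↔ c ∈ S ∧ ordVal R K c = 1) {z : K} (hz : z ∈ V) : ∃ c ∈ M, c * z ∈ S := by
  have hVmem {z : K} : z ∈ V ↔ ordVal R K z ≤ 1 := by
    rw [← mem_ordValuationRing_iff, ← hVord]; rfl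
  obtain ⟨a', ha', ha0', P, hP, rfl⟩ := hV
  have haK : algebraMap R K a ≠ 0 := by
    rwa [Ne, (IsFractionRing.injective R K).eq_iff' (map_zero _)]
  have haK' : algebraMap R K a' ≠ 0 := by
    rwa [Ne, (IsFractionRing.injective R K).eq_iff' (map_zero _)]
  have htS := div_mem_of_mem_normalizedBlowupChart_le hB ha'
  have htV := div_mem_of_mem_normalizedBlowupChart_le (le_localizationAt _ P) ha
  -- `a'/a` lies in `S` and its inverse in `V`, so it has order 0. Multiplying by its powers carries
  -- `R[I/a']` into `R[I/a]`, hence into `S`.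
  have htM : algebraMap R K a' / algebraMap R K a ∈ M := by
    refine (hM _).2 ⟨htS, le_antisymm (hSV _ htS) ?_⟩
    rw [hVmem, ← inv_div, map_inv₀, inv_le_one₀] at htV
    · exact htV
    · rw [zero_lt_iff, Valuation.ne_zero_iff]
      exact div_ne_zero haK' haK
  have hchart : ∀ z ∈ normalizedBlowupChart K I a', ∃ c ∈ M, c * z ∈ S := by
    intro z hz
    refine exists_mul_mem_of_isIntegral hS (fun c hc => ((hM c).1 hc).1) (fun z hz => ?_)
      (mem_normalizedBlowupChart.1 hz)
    obtain ⟨k, f, hf, rfl⟩ := (mem_blowupChart ha' haK').1 hz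
    refine ⟨_, M.pow_mem htM k, ?_⟩
    rw [div_pow, mul_comm, div_mul_div_cancel₀ (pow_ne_zero k haK')]
    exact hB (blowupChart_le_normalizedBlowupChart I a ((mem_blowupChart ha haK).2 ⟨k, f, hf, rfl⟩))
  obtain ⟨b, d, hd, rfl⟩ := hz
  obtain ⟨c, hc, hcb⟩ := hchart b b.2
  obtain ⟨c', hc', hcd⟩ := hchart d d.2
  have hd0 := coe_ne_zero_of_notMem hd
  have hd1 : ordVal R K d = 1 := by
    refine le_antisymm (hVmem.1 (le_localizationAt _ P d.2)) ?_
    have := hVmem.1 (inv_mem_localizationAt hd)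
    rwa [map_inv₀, inv_le_one₀] at this
    rw [zero_lt_iff, Valuation.ne_zero_iff]
    exact hd0
  have hcdM : c' * d ∈ M := (hM _).2 ⟨hcd, by rw [map_mul, ((hM _).1 hc').2, hd1, one_mul]⟩
  refine ⟨c' * d * c, M.mul_mem hcdM hc, ?_⟩
  have : c' * (d : K) * c * (b / d) = c' * (c * b) := by field_simp
  rw [this]
  exact mul_mem ((hM _).1 hc').1 hcb

/-- If the order valuation ring is a localization of `S`, the generator of the divisorial hull of
`𝔪ⁿS` has order `n`. -/
theorem IsHullGenerator.ordVal_div_eq_one {S : Subalgebra R K} (hSV : ∀ z ∈ S, ordVal R K z ≤ 1)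
    {M : Submonoid K} (hM : ∀ c, c ∈ M ↔ c ∈ S ∧ ordVal R K c = 1) {V : Subalgebra R K}
    (hVmem : ∀ z, z ∈ V ↔ ordVal R K z ≤ 1) (hV : ∀ z ∈ V, ∃ c ∈ M, c * z ∈ S) {x : R}
    (hx : x ∈ maximalIdeal R) (hx' : x ∉ maximalIdeal R ^ 2) {n : ℕ} {g : K}
    (hg : IsHullGenerator (maximalIdeal R) S n g) :
    ordVal R K (algebraMap R K x ^ n / g) = 1 := by
  classical
  have hx0 : algebraMap R K x ≠ 0 := algebraMap_ne_zero_of_notMem_sq hx'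
  have huS : algebraMap R K x ^ n / g ∈ S := by
    rw [← map_pow]; exact hg.div_mem _ (Ideal.pow_mem_pow hx n)
  refine le_antisymm (hSV _ huS) ?_
  obtain ⟨s, hs⟩ : (maximalIdeal R ^ n).FG := IsNoetherian.noetherian _
  -- `c` clears the denominators of the generators `y/xⁿ`, all of which lie in `V`. With `u = xⁿ/g`
  -- this reads `(c/u)(y/g) ∈ S`, so the hull property gives `c/u ∈ S`, and `c` of order 0 forces
  -- `u` to have order at most 0.
  obtain ⟨c, hc, hcs⟩ := exists_common_mul_mem (fun c hc => ((hM c).1 hc).1) hV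
    (s.image fun y => algebraMap R K y / algebraMap R K x ^ n) (by
      intro z hz
      obtain ⟨y, hy, rfl⟩ := Finset.mem_image.1 hz
      have hym : y ∈ maximalIdeal R ^ n := hs ▸ Ideal.subset_span hy
      exact (hVmem _).2 ((ordVal_div_pow_le_iff hx hx' (l := 0)).2 hym))
  have hall : ∀ y ∈ maximalIdeal R ^ n, c * (algebraMap R K y / algebraMap R K x ^ n) ∈ S := by
    intro y hy
    rw [← hs] at hy
    induction hy using Submodule.span_induction with
    | mem y hy => exact hcs _ (Finset.mem_image_of_mem _ hy)
    | zero => simp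
    | add a b _ _ ha hb => rw [map_add, add_div, mul_add]; exact add_mem ha hb
    | smul a b _ hb =>
      rw [smul_eq_mul, map_mul, mul_div_assoc, mul_left_comm]
      exact mul_mem (S.algebraMap_mem a) hb
  have hzS : c / (algebraMap R K x ^ n / g) ∈ S := hg.mem _ fun y hy => by
    have := hall y hy
    have heq : c / (algebraMap R K x ^ n / g) * (algebraMap R K y / g)
        = c * (algebraMap R K y / algebraMap R K x ^ n) := by
      have := hg.ne_zero
      field_simp
    rwa [heq]
  have h1 := hSV _ hzS
  rw [map_div₀, ((hM c).1 hc).2, one_div, inv_le_one₀] at h1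
  · exact h1
  · rw [zero_lt_iff, Valuation.ne_zero_iff]
    exact div_ne_zero (pow_ne_zero n hx0) hg.ne_zero

end

end BirationalModel

end

/-! ### The two cases combined. -/

open BirationalModel IsRegularLocalRing in
theorem lemma2p40 {R K : Type*} [CommRing R] [IsDomain R] [IsRegularLocalRing R]
    [Field K] [Algebra R K] [IsFractionRing R K]
    (hdim : 2 ≤ ringKrullDim R)
    (I : Ideal R) (hprim : I.IsPrimary) (hrad : I.radical = IsLocalRing.maximalIdeal R)
    (hfin : (BirationalModel.basePointsInFirstNeighborhood K I).Finite)
    (S : Subalgebra R K) (hS : S ∈ BirationalModel.normalizedBlowup K I)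
    (hdom : BirationalModel.Dominates S)
    (h : UniqueFactorizationMonoid S ∨
      (BirationalModel.HasTorsionDivisorClassGroup S ∧
        ((∃ V ∈ BirationalModel.reesValuationRings K I,
            (V : Set K) = BirationalModel.ordValuationRing R K) ∨
          ¬ (S : Set K) ⊆ BirationalModel.ordValuationRing R K))) :
    Submodule.IsPrincipal ((IsLocalRing.maximalIdeal R).map (algebraMap R S)) := by
  have hm : IsLocalRing.maximalIdeal R ≠ ⊥ := by
    intro h0
    have := IsLocalRing.maximalIdeal_height_eq_ringKrullDim (R := R)
    rw [h0, Ideal.height_bot] at this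
    rw [← this] at hdim
    exact absurd hdim (by decide)
  have hSint : ∀ z : K, IsIntegral S z → z ∈ S := fun z hz =>
    mem_of_isIntegral_of_mem_normalizedBlowup hS hz
  have hSloc := isLocalRing_of_mem_normalizedBlowup hS
  obtain ⟨a, ha, ha0, P, hP, hSP⟩ := hS
  have hB : normalizedBlowupChart K I a ≤ S := hSP ▸ le_localizationAt _ P
  obtain ⟨r, hI, b, hb, hb'⟩ := exists_order (I := I) (fun h0 => ha0 (by simpa [h0] using ha))
  have hr : 0 < r := by
    rw [Nat.pos_iff_ne_zero]
    rintro rfl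
    exact hb' (by rw [zero_add, pow_one, ← hrad]; exact Ideal.le_radical hb)
  -- The value of `a` is that of `I`, because `IS = aS`; the dichotomy is whether it can equal the
  -- `r`-th power of the value of `𝔪`.
  by_cases H : ∃ W : ValuationSubring K, DominatesRing W.valuation S ∧ ∃ x,
      IsBlowupCenter W.valuation x ∧
        W.valuation (algebraMap R K a) = W.valuation (algebraMap R K x) ^ r
  swap
  · push Not at H
    refine isPrincipal_of_forall_valuation_lt hm hrad hfin hSint hdom hI hb hb'
      fun W hW x hx y hy => lt_of_le_of_lt ?_ (lt_of_le_of_ne (hx.le_pow (hI ha)) (H W hW x hx))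
    have hya := hW.le_one _ (div_mem_of_mem_normalizedBlowupChart_le hB hy)
    rwa [map_div₀, div_le_one₀] at hya
    rw [zero_lt_iff, Valuation.ne_zero_iff, Ne,
      (IsFractionRing.injective R K).eq_iff' (map_zero _)]
    exact ha0
  obtain ⟨W, hW, x, hx, hva⟩ := H
  have hST : S ≤ hx.transform := by
    subst hSP
    exact le_transform hx hI ha hva hW
  rcases h with hufd | ⟨htors, hV⟩
  · obtain ⟨g, hg⟩ := exists_isHullGenerator_of_uniqueFactorizationMonoid
      (IsNoetherian.noetherian (IsLocalRing.maximalIdeal R)) hm S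
    refine hg.isPrincipal_map hW hx one_pos hr (hI ha) hva ?_
    rw [pow_one]
    exact hg.valuation_eq_of_lt_one hx hST
      (hg.valuation_lt_one_of_uniqueFactorizationMonoid hrad ha ha0 hB hdom hW)
  · have hSV : ∀ z ∈ S, ordVal R K z ≤ 1 := fun z hz => hx.ordVal_le_one (hST hz)
    -- `S` lies in the ring of `ord_R` here, so only the Rees valuation alternative remains.
    obtain ⟨V, ⟨hV, -⟩, hVord⟩ := hV.resolve_right
      (not_not.2 fun z hz => mem_ordValuationRing_iff.2 (hSV z hz))
    obtain ⟨n, hn, g, hg⟩ := exists_isHullGenerator_of_torsion hm S htors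
    let M : Submonoid K :=
      { carrier := {c | c ∈ S ∧ ordVal R K c = 1}
        one_mem' := ⟨S.one_mem, map_one _⟩
        mul_mem' := fun h h' => ⟨S.mul_mem h.1 h'.1, by rw [map_mul, h.2, h'.2, one_mul]⟩ }
    have hVmem : ∀ z, z ∈ V ↔ ordVal R K z ≤ 1 := fun z => by
      rw [← mem_ordValuationRing_iff, ← hVord]; rfl
    have hone := hg.ordVal_div_eq_one hSV (M := M) (fun _ => Iff.rfl) hVmem
      (fun z hz => exists_mul_mem_of_ordVal_le_one ha ha0 hSint hB hSV hV hVord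
        (fun _ => Iff.rfl) hz) hx.mem hx.notMem_sq
    refine hg.isPrincipal_map hW hx hn hr (hI ha) hva
      (hx.ordVal_mul_eq_one (hST hg.self_mem) (hST ?_) (mul_div_cancel₀ _ hg.ne_zero).symm hone)
    rw [← map_pow]
    exact hg.div_mem _ (Ideal.pow_mem_pow hx.mem n)
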